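/- \textbf{Convergence of the Byzantine-resilient zero-order method, $\mu>0$.} \emph{Setting.} Let $d,k,m,n\ge 1$ be integers, $\mathsf D$ a probability distribution on a data space $\Gamma$, and $f(\cdot;\gamma):\mathbb R^d\to\mathbb R$ ($\gamma\in\Gamma$) a loss with $f(w;\cdot)$ integrable for every $w$; put $F(w)=\mathbb E_{\gamma\sim\mathsf D}[f(w;\gamma)]$. Let $\mathcal W\subset\mathbb R^d$ be convex and compact with diameter $D$, let $\mathbb S^d$ be the unit sphere of $\mathbb R^d$ with its uniform distribution, and fix $\mu>0$. Let $$g(w,z,\gamma)=d\,\frac{f(w+\mu z;\gamma)-f(w-\mu z;\gamma)}{2\mu},\qquad F_\mu(w)=\mathbb E_{z\sim\mathbb S^d}[F(w+\mu z)].$$ Each of $m$ clients holds $n$ samples, all samples $\gamma^{i,j}$ being i.i.d. with law $\mathsf D$; put $g_i(w,z)=\frac1n\sum_{j=1}^n g(w,z,\gamma^{i,j})$. A set $\mathcal B$ of exactly $\alpha m$ clients is Byzantine. For $0\le\beta<\frac12$ the trimmed mean $\operatorname{TrMn}_\beta$ of $m$ real numbers is the average of the numbers that remain after the $\lfloor\beta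 m\rfloor$ largest and the $\lfloor\beta m\rfloor$ smallest are removed. \emph{Algorithm.} Start from $w^0\in\mathcal W$. In round $t$, $k$ directions $z^t_1,\dots,z^t_k$ are drawn uniformly from $\mathbb S^d$, independently of each other, of the earlier rounds and of the samples. For each $r$, every client $i\notin\mathcal B$ sends $g_i(w^t,z^t_r)$, and every client in $\mathcal B$ sends an arbitrary real number, which may depend (measurably in the directions) on all samples and on all directions and messages up to and including round $t$. With $\hat g^t_r$ the $\beta$-trimmed mean of the $m$ numbers received for $z^t_r$, $$w^{t+1}=\Pi_{\mathcal W}\Big(w^t-\eta\,\frac1k\sum_{r=1}^k\hat g^t_r\,z^t_r\Big),$$ where $\Pi_{\mathcal W}$ is the Euclidean projection onto $\mathcal W$ and $$\tau=\frac{2d+(k-1)(1+\sqrt d)}{k},\qquad \eta=\frac1{2\tau L_F}.$$ \emph{Assumptions.} (i) For all $\gamma\in\Gamma$: $g(\cdot,z,\gamma)$ is $L_{w,\mu}$-Lipschitz on $\mathcal W$ for every $z\in\mathbb S^d$, and $g(w,\cdot,\gamma)$ is $L_{z,\mu}$-Lipschitz on $\mathbb S^d$ for every $w\in\mathcal W$;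 put $\hat L=L_{w,\mu}+L_{z,\mu}$. Every $f(\cdot;\gamma)$ is $L$-smooth and $F$ is $L_F$-smooth on $\mathbb R^d$ (differentiable with Lipschitz gradient). (ii) For some $v>0$ and all $w\in\mathcal W$, $z\in\mathbb S^d$, the random variable $X=g(w,z,\gamma)$, $\gamma\sim\mathsf D$, is $v$-sub-exponential: $\mathbb E\,e^{l(X-\mathbb EX)}\le e^{v^2l^2/2}$ for $|l|<1/v$. (iii) $F$ is $\lambda$-strongly convex on $\mathbb R^d$, $\lambda>0$. (iv) $w_\mu^*\in\mathcal W$ minimises $F_\mu$ over $\mathcal W$ and is a local minimum of $F_\mu$ on $\mathbb R^d$. (v) $\varepsilon>0$ and $\alpha\le\beta<\frac12-\varepsilon$. \emph{Theorem.} There is an absolute constant $C>0$ such that the following holds for all data as above. Put $$\Lambda=\log(1+nm\hat LD)+\log(1+2nm\hat L)+\tfrac1d\log m,$$ $$\Delta=\sqrt{\Lambda}\;\frac{v\sqrt d}{\varepsilon}\Big(\frac{3\beta}{\sqrt n}+\frac{\sqrt2}{\sqrt{nm}}\Big)+C\,\frac{1+v\,d\,\Lambda}{\varepsilon}\Big(\frac{\beta}{n}+\frac1{mn}\Big).$$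 There is an event, determined by the samples, of probability at least $$1-\frac{4}{(1+2nm\hat L)^d(1+nm\hat LD)^d},$$ on which, for every behaviour of the Byzantine clients, every $w^0\in\mathcal W$ and every $T\ge0$, the expectation over all the drawn directions satisfies $$\mathbb E\,\|w^T-w_\mu^*\|_2\le\Big(1-\frac{\lambda}{2\tau(L_F+\lambda)}\Big)^T\|w^0-w_\mu^*\|_2+\frac2\lambda\Delta+\frac{8\sqrt2\,\mu\,d\,L_F}{\lambda}\sqrt{1+\frac\tau4}.$$ -/

import Mathlib

open MeasureTheory Set
open scoped NNReal ENNReal RealInnerProductSpace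

noncomputable section

namespace CyberZero

/-- The parameter space `ℝ^d` with the Euclidean norm. -/
abbrev Vec (d : ℕ) : Type := EuclideanSpace ℝ (Fin d)

/-- The unit sphere of `ℝ^d`. -/
abbrev Sph (d : ℕ) : Type := Metric.sphere (0 : Vec d) 1

/-- The uniform probability measure on the unit sphere: normalised surface measure. -/
def sphereUniform (d : ℕ) : Measure (Sph d) :=
  ((volume : Measure (Vec d)).toSphere univ)⁻¹ • (volume : Measure (Vec d)).toSphere

/-- The joint law of the directions of `T` rounds: `k` independent uniform directions per round,
independent between rounds. -/
def directionsLaw (d k T : ℕ) : Measure (Fin T → Fin k → Sph d) :=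
  Measure.pi fun _ => Measure.pi fun _ => sphereUniform d

/-- The law of the samples of `m` clients with `n` samples each, all i.i.d. with law `P`. -/
def samplesLaw {Γ : Type*} [MeasurableSpace Γ] (P : Measure Γ) (m n : ℕ) :
    Measure (Fin m → Fin n → Γ) :=
  Measure.pi fun _ => Measure.pi fun _ => P

/-- Differentiable with `L`-Lipschitz gradient. -/
def IsSmooth {d : ℕ} (L : ℝ≥0) (h : Vec d → ℝ) : Prop :=
  Differentiable ℝ h ∧ LipschitzWith L (gradient h)

/-- `X` is `v`-sub-exponential under `P`: it is integrable and
`E[exp (l (X - E X))] ≤ exp (v² l² / 2)` for all `|l| < 1 / v`. -/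
def IsSubExponential {Γ : Type*} [MeasurableSpace Γ] (P : Measure Γ) (v : ℝ) (X : Γ → ℝ) : Prop :=
  Integrable X P ∧ ∀ l : ℝ, |l| < 1 / v →
    Integrable (fun γ => Real.exp (l * (X γ - ∫ γ', X γ' ∂P))) P ∧
    ∫ γ, Real.exp (l * (X γ - ∫ γ', X γ' ∂P)) ∂P ≤ Real.exp (v ^ 2 * l ^ 2 / 2)

/-- The population loss `F(w) = E_{γ ∼ P}[f(w; γ)]`. -/
def populationLoss {d : ℕ} {Γ : Type*} [MeasurableSpace Γ] (P : Measure Γ) (f : Vec d → Γ → ℝ)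
    (w : Vec d) : ℝ :=
  ∫ γ, f w γ ∂P

/-- The sphere-smoothed version `F_μ(w) = E_z[F(w + μ z)]`, `z` uniform on the unit sphere. -/
def smoothedLoss {d : ℕ} (F : Vec d → ℝ) (μ : ℝ) (w : Vec d) : ℝ :=
  ∫ z : Sph d, F (w + μ • (z : Vec d)) ∂(sphereUniform d)

/-- The (signed) scalar `d (f(w + μ z; γ) - f(w - μ z; γ)) / (2 μ)` of the two-point zero-order
estimate; the vector-valued estimate is this scalar times `z`. -/
def zoCoeff {d : ℕ} {Γ : Type*} (f : Vec d → Γ → ℝ) (μ : ℝ) (w z : Vec d) (γ : Γ) : ℝ :=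
  d * ((f (w + μ • z) γ - f (w - μ • z) γ) / (2 * μ))

/-- A client's estimate: the average of the scalars `zoCoeff` over its `n` samples. -/
def clientCoeff {d n : ℕ} {Γ : Type*} (f : Vec d → Γ → ℝ) (μ : ℝ) (samples : Fin n → Γ)
    (w z : Vec d) : ℝ :=
  (1 / n : ℝ) * ∑ j, zoCoeff f μ w z (samples j)

/-- The `β`-trimmed mean of `x_1, …, x_m`: sort, remove the `⌊β m⌋` smallest and the `⌊β m⌋`
largest entries, and divide the sum of the others by `m - 2 ⌊β m⌋`. -/
def trimmedMean {m : ℕ} (β : ℝ) (x : Fin m → ℝ) : ℝ :=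
  (∑ i ∈ (Finset.univ : Finset (Fin m)).filter
      (fun i => ⌊β * m⌋₊ ≤ i.val ∧ i.val + ⌊β * m⌋₊ < m), x (Tuple.sort x i)) /
    ((m : ℝ) - 2 * (⌊β * m⌋₊ : ℝ))

/-- The Euclidean projection on `W` (a point of `W` nearest to `x`; it exists and is unique when
`W` is nonempty, closed and convex). -/
def euclideanProj {d : ℕ} (W : Set (Vec d)) (x : Vec d) : Vec d :=
  Classical.epsilon fun p => p ∈ W ∧ ∀ q ∈ W, ‖p - x‖ ^ 2 ≤ ‖q - x‖ ^ 2

/-- The `m` values which the federator receives for one direction `z`: client `i ∉ B` sends its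
estimate, client `i ∈ B` (Byzantine) sends the arbitrary value `a i`. -/
def messages {d m n : ℕ} {Γ : Type*} (f : Vec d → Γ → ℝ) (μ : ℝ) (B : Finset (Fin m))
    (samples : Fin m → Fin n → Γ) (w z : Vec d) (a : Fin m → ℝ) (i : Fin m) : ℝ :=
  if i ∈ B then a i else clientCoeff f μ (samples i) w z

/-- The robust gradient estimate `(1/k) ∑_r TrMn_β{messages for z_r} z_r`; `a i r` is the value
sent by the Byzantine client `i` for the direction `z_r`. -/
def robustGradient {d k m n : ℕ} {Γ : Type*} (f : Vec d → Γ → ℝ) (μ β : ℝ) (B : Finset (Fin m))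
    (samples : Fin m → Fin n → Γ) (w : Vec d) (z : Fin k → Sph d) (a : Fin m → Fin k → ℝ) :
    Vec d :=
  (1 / k : ℝ) • ∑ r, trimmedMean β (messages f μ B samples w (z r) (fun i => a i r)) • (z r : Vec d)

/-- A strategy of the Byzantine clients, for a given set of samples: the values sent in round `t`
are an arbitrary (measurable) function of the directions of the rounds `0, …, t`. Since, given the
samples and the strategy, these directions determine all models and all messages of the other
clients up to round `t`, this is an adversary with complete knowledge of them. -/
structure Strategy (d k m : ℕ) where
  send : (t : ℕ) → (Fin (t + 1) → Fin k → Sph d) → Fin m → Fin k → ℝ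
  measurable_send : ∀ t, Measurable (send t)

/-- The model `w^t` after `t` rounds, as a function of the directions of these rounds. -/
def iterate {d k m n : ℕ} {Γ : Type*} (f : Vec d → Γ → ℝ) (W : Set (Vec d)) (μ β η : ℝ)
    (B : Finset (Fin m)) (samples : Fin m → Fin n → Γ) (adv : Strategy d k m) (w₀ : Vec d) :
    (t : ℕ) → (Fin t → Fin k → Sph d) → Vec d
  | 0, _ => w₀
  | t + 1, Z =>
    let w := iterate f W μ β η B samples adv w₀ t (fun s => Z s.castSucc)
    euclideanProj W
      (w - η • robustGradient f μ β B samples w (Z (Fin.last t)) (adv.send t Z))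

/-- `τ = (2d + (k - 1)(1 + √d)) / k`. -/
def tau (d k : ℕ) : ℝ := (2 * d + ((k : ℝ) - 1) * (1 + √(d : ℝ))) / k

/-- `log(1 + n m L D) + log(1 + 2 n m L) + (1/d) log m`. -/
def logFactor (d n m : ℕ) (L D : ℝ) : ℝ :=
  Real.log (1 + n * m * L * D) + Real.log (1 + 2 * n * m * L) + 1 / d * Real.log m

/-- The robustness error `Δ`. The second summand is the term `Õ(β/n + 1/(mn))` with its
dependence on the logarithmic factor and on `v`, `d`, `ε` written out, `C` being the implied
constant. -/
def robustnessError (C : ℝ) (d n m : ℕ) (v ε β L D : ℝ) : ℝ :=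
  √(logFactor d n m L D) * (v * √(d : ℝ) / ε) * (3 * β / √(n : ℝ) + √2 / √((n : ℝ) * m)) +
    C * ((1 + v * d * logFactor d n m L D) / ε) * (β / n + 1 / (m * n))

/-- The failure probability `4 / ((1 + 2 n m L)^d (1 + n m L D)^d)`. -/
def failureProb (d n m : ℕ) (L D : ℝ) : ℝ :=
  4 / ((1 + 2 * n * m * L) ^ d * (1 + n * m * L * D) ^ d)

end CyberZero

end

/-!
# Convergence of the Byzantine-resilient zero-order method

The proof has a statistical half and an optimization half, which meet in one number, the
robustness error `Δ`.

*Statistics.* For fixed `w` and `z`, Bernstein's inequality for sub-exponential variables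
(`measureReal_abs_sum_samples_ge`) bounds the deviation of each honest client and that of the sum
over all honest clients. The trimmed mean differs from the honest average by at most `3 ⌊β m⌋`
terms, each of which is as close to the mean as the worst honest client, since whatever survives the
trimming lies between two honest values (`abs_trimmedMean_sub_le`). A union bound over nets of `W`
and of the sphere, of radii `2 / (n m L̂)` and `1 / (n m L̂)` with `L̂` the sum of the two Lipschitz
constants, and the Lipschitz conditions between net points make this uniform
(`exists_event_robust`): on the event, whatever the Byzantine clients send, every trimmed mean is
within `Δ` of `d (F(w + μ z) - F(w - μ z)) / (2 μ)`.

*Optimization.* By smoothness of `F` this central difference is `d ⟨∇F(w), z⟩` up to `d L_F μ / 2`,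
so the robust gradient is, up to that error and `Δ`, the image of `∇F(w)` under the random linear
map `A = (d / k) ∑_r z_r z_rᵀ` (`sketch`). The second moments of the uniform distribution on the
sphere give `E A = 1` and `E A² = (d + k - 1) / k ≤ τ / 2`. Hence a step of size `1 / (2 τ L_F)`
along `A (∇F(w) - ∇F(w*))` contracts `w - w*` in mean square, by cocoercivity of the gradient of a
smooth strongly convex function (`StrongConvexOn.inner_gradient_sub_ge`). What remains is
`A ∇F(w*)`, and `∇F(w*)` is at most `L_F μ`, because `w*` is a local minimum of the smoothed loss
(`norm_gradient_le_of_isLocalMin_smoothedLoss`). The gradient of the smoothed loss itself is never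
needed, and neither is the fact that the estimate is unbiased for a smoothed gradient.

The bound for one round depends on the adversary only through `Δ`, so given the past it can be
integrated over the directions of the last round alone (`integral_norm_iterate_succ_le`); the
theorem follows by summing the resulting geometric recursion.
-/

namespace CyberZero

/-! ### Smooth and strongly convex functions -/

section Convex

variable {E : Type*} [NormedAddCommGroup E] [InnerProductSpace ℝ E] [CompleteSpace E]
  {F : E → ℝ} {L : ℝ≥0} {lam : ℝ}

/-- The derivative of `F` along the segment from `x` in direction `h`. -/
lemma hasDerivAt_comp_segment (hF : Differentiable ℝ F) (x h : E) (t : ℝ) :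
    HasDerivAt (fun s : ℝ => F (x + s • h)) ⟪gradient F (x + t • h), h⟫ t := by
  have h1 : HasDerivAt (fun s : ℝ => x + s • h) h t := by
    simpa using ((hasDerivAt_id t).smul_const h).const_add x
  have h2 := (hF (x + t • h)).hasGradientAt.hasFDerivAt
  exact h2.comp_hasDerivAt t h1

/-- The two-sided quadratic bound for a function with Lipschitz gradient. -/
lemma abs_sub_sub_inner_gradient_le (hF : Differentiable ℝ F) (hL : LipschitzWith L (gradient F))
    (x h : E) : |F (x + h) - F x - ⟪gradient F x, h⟫| ≤ L / 2 * ‖h‖ ^ 2 := by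
  have hd : ∀ t : ℝ, HasDerivAt (fun s : ℝ => F (x + s • h) - F x - s * ⟪gradient F x, h⟫)
      (⟪gradient F (x + t • h), h⟫ - ⟪gradient F x, h⟫) t := fun t =>
    (((hasDerivAt_comp_segment hF x h t).sub_const (F x)).sub
      ((hasDerivAt_id t).mul_const ⟪gradient F x, h⟫)).congr_deriv (by rw [one_mul])
  have hB : ∀ t : ℝ, HasDerivAt (fun s : ℝ => L / 2 * ‖h‖ ^ 2 * s ^ 2)
      (L * ‖h‖ ^ 2 * t) t := fun t =>
    ((hasDerivAt_pow 2 t).const_mul (L / 2 * ‖h‖ ^ 2 : ℝ)).congr_deriv (by norm_num; ring)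
  have key := image_norm_le_of_norm_deriv_right_le_deriv_boundary (a := 0) (b := 1)
    (fun t _ => (hd t).continuousAt.continuousWithinAt)
    (fun t _ => (hd t).hasDerivWithinAt) (by simp) hB (fun t ht => ?_)
    (right_mem_Icc.2 zero_le_one)
  · simpa [Real.norm_eq_abs] using key
  · rw [← inner_sub_left]
    have h1 : ‖gradient F (x + t • h) - gradient F x‖ ≤ L * (t * ‖h‖) := by
      have := hL.dist_le_mul (x + t • h) x
      rw [dist_eq_norm, dist_eq_norm] at this
      simpa [norm_smul, abs_of_nonneg ht.1] using this
    calc ‖⟪gradient F (x + t • h) - gradient F x, h⟫‖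
        ≤ ‖gradient F (x + t • h) - gradient F x‖ * ‖h‖ := norm_inner_le_norm _ _
      _ ≤ L * (t * ‖h‖) * ‖h‖ := by gcongr
      _ = L * ‖h‖ ^ 2 * t := by ring

/-- The first-order lower bound for a smooth strongly convex function. -/
lemma StrongConvexOn.add_inner_gradient_le (hF : Differentiable ℝ F)
    (hL : LipschitzWith L (gradient F)) (hc : StrongConvexOn univ lam F) (x h : E) :
    F x + ⟪gradient F x, h⟫ + lam / 2 * ‖h‖ ^ 2 ≤ F (x + h) := by
  have key : ∀ t ∈ Ioo (0 : ℝ) 1, ⟪gradient F x, h⟫ - L / 2 * ‖h‖ ^ 2 * t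
      ≤ F (x + h) - F x - (1 - t) * (lam / 2 * ‖h‖ ^ 2) := by
    intro t ht
    have h1 := hc.2 (mem_univ x) (mem_univ (x + h)) (sub_nonneg.2 ht.2.le) ht.1.le (by ring)
    have h2 := (abs_le.1 (abs_sub_sub_inner_gradient_le hF hL x (t • h))).1
    have h3 : (1 - t) • x + t • (x + h) = x + t • h := by module
    rw [h3] at h1
    simp only [smul_eq_mul, sub_add_cancel_left, norm_neg] at h1
    rw [inner_smul_right, norm_smul, Real.norm_eq_abs, abs_of_pos ht.1] at h2
    refine le_of_mul_le_mul_left ?_ ht.1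
    nlinarith
  have h0 : Filter.Tendsto (fun t : ℝ => ⟪gradient F x, h⟫ - L / 2 * ‖h‖ ^ 2 * t)
      (nhdsWithin 0 (Ioi 0)) (nhds (⟪gradient F x, h⟫ - L / 2 * ‖h‖ ^ 2 * 0)) :=
    ((by fun_prop : Continuous fun t : ℝ => ⟪gradient F x, h⟫ - L / 2 * ‖h‖ ^ 2 * t).tendsto
      0).mono_left nhdsWithin_le_nhds
  have h1 : Filter.Tendsto (fun t : ℝ => F (x + h) - F x - (1 - t) * (lam / 2 * ‖h‖ ^ 2))
      (nhdsWithin 0 (Ioi 0)) (nhds (F (x + h) - F x - (1 - 0) * (lam / 2 * ‖h‖ ^ 2))) :=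
    ((by fun_prop : Continuous fun t : ℝ =>
      F (x + h) - F x - (1 - t) * (lam / 2 * ‖h‖ ^ 2)).tendsto 0).mono_left nhdsWithin_le_nhds
  have := le_of_tendsto_of_tendsto h0 h1
    (Filter.eventually_of_mem (Ioo_mem_nhdsGT one_pos) key)
  linarith

/-- The strong convexity parameter is at most the smoothness parameter. -/
lemma StrongConvexOn.le_lipschitz [Nontrivial E] (hF : Differentiable ℝ F)
    (hL : LipschitzWith L (gradient F)) (hc : StrongConvexOn univ lam F) : lam ≤ L := by
  obtain ⟨h, hh⟩ := exists_ne (0 : E)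
  have h1 := StrongConvexOn.add_inner_gradient_le hF hL hc 0 h
  have h2 := (abs_le.1 (abs_sub_sub_inner_gradient_le hF hL 0 h)).2
  have h3 : 0 < ‖h‖ ^ 2 := by positivity
  refine le_of_mul_le_mul_right ?_ h3
  linarith

/-- Cocoercivity of the gradient of a smooth strongly convex function. The subtraction of
`lam / 2 * ‖·‖ ^ 2` reduces it to the convex case with smoothness constant `L - lam`, where one
compares the values at the points reached from `a` and from `b` by a gradient step of
length `s`. -/
lemma StrongConvexOn.inner_gradient_sub_ge (hF : Differentiable ℝ F)
    (hL : LipschitzWith L (gradient F)) (hc : StrongConvexOn univ lam F) (hle : lam ≤ L)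
    (a b : E) :
    ‖gradient F a - gradient F b‖ ^ 2 + lam * L * ‖a - b‖ ^ 2
      ≤ (L + lam) * ⟪a - b, gradient F a - gradient F b⟫ := by
  set p : E := gradient F a - gradient F b - lam • (a - b) with hp
  have half : ∀ (a b p : E) (s : ℝ), F b + ⟪gradient F b, a - b⟫ - s * ⟪gradient F b, p⟫
      + lam / 2 * (‖a - b‖ ^ 2 - 2 * s * ⟪a - b, p⟫ + s ^ 2 * ‖p‖ ^ 2)
      ≤ F a - s * ⟪gradient F a, p⟫ + L / 2 * (s ^ 2 * ‖p‖ ^ 2) := by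
    intro a b p s
    have h1 := StrongConvexOn.add_inner_gradient_le hF hL hc b (a - b - s • p)
    have h2 := (abs_le.1 (abs_sub_sub_inner_gradient_le hF hL a (-(s • p)))).2
    have h3 : b + (a - b - s • p) = a + -(s • p) := by abel
    rw [h3, norm_sub_sq_real] at h1
    simp only [inner_sub_right, inner_smul_right, inner_neg_right, norm_neg, norm_smul, mul_pow,
      Real.norm_eq_abs, sq_abs] at h1 h2
    simp only [inner_sub_right]
    linarith
  have hsum : ∀ s : ℝ, (2 * s - (L - lam) * s ^ 2) * ‖p‖ ^ 2 ≤ ⟪a - b, p⟫ := by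
    intro s
    have h1 := half a b p s
    have h2 := half b a (-p) s
    have e1 : ‖b - a‖ = ‖a - b‖ := norm_sub_rev _ _
    have e2 : ⟪b - a, -p⟫ = ⟪a - b, p⟫ := by rw [← neg_sub a b, inner_neg_neg]
    have e3 : ⟪gradient F a, b - a⟫ = -⟪gradient F a, a - b⟫ := by
      rw [← neg_sub a b, inner_neg_right]
    have e0 : gradient F a - gradient F b = p + lam • (a - b) := by
      rw [hp]
      abel
    have e4 : ⟪gradient F a, p⟫ - ⟪gradient F b, p⟫ = ‖p‖ ^ 2 + lam * ⟪a - b, p⟫ := by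
      rw [← inner_sub_left, e0, inner_add_left, real_inner_smul_left, real_inner_self_eq_norm_sq]
    have e5 : ⟪gradient F a, a - b⟫ - ⟪gradient F b, a - b⟫
        = ⟪a - b, p⟫ + lam * ‖a - b‖ ^ 2 := by
      rw [← inner_sub_left, e0, inner_add_left, real_inner_smul_left, real_inner_self_eq_norm_sq,
        real_inner_comm]
    rw [e1, e2, e3, inner_neg_right, inner_neg_right, norm_neg] at h2
    have e6 : s * ⟪gradient F a, p⟫ - s * ⟪gradient F b, p⟫
        = s * (‖p‖ ^ 2 + lam * ⟪a - b, p⟫) := by rw [← mul_sub, e4]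
    linarith
  have hfin : ‖p‖ ^ 2 ≤ (L - lam) * ⟪a - b, p⟫ := by
    rcases hle.eq_or_lt with h | h
    · have h1 : (L : ℝ) - lam = 0 := by linarith
      rw [h1] at hsum ⊢
      by_contra hcon
      have hpos : 0 < ‖p‖ ^ 2 := by linarith
      have hne : ‖p‖ ≠ 0 := fun h => by simp [h] at hpos
      have := hsum ((⟪a - b, p⟫ + 1) / (2 * ‖p‖ ^ 2))
      have e : 2 * ((⟪a - b, p⟫ + 1) / (2 * ‖p‖ ^ 2)) * ‖p‖ ^ 2 = ⟪a - b, p⟫ + 1 := by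
        field_simp
      linarith
    · have h0 := hsum (1 / (L - lam))
      have hpos : 0 < (L : ℝ) - lam := by linarith
      have e : (2 * (1 / ((L : ℝ) - lam)) - (L - lam) * (1 / (L - lam)) ^ 2) * ‖p‖ ^ 2
          = ‖p‖ ^ 2 / (L - lam) := by
        field_simp
        ring
      rwa [e, div_le_iff₀' hpos] at h0
  have e1 : ‖p‖ ^ 2 = ‖gradient F a - gradient F b‖ ^ 2
      - 2 * lam * ⟪a - b, gradient F a - gradient F b⟫ + lam ^ 2 * ‖a - b‖ ^ 2 := by
    rw [hp, norm_sub_sq_real, real_inner_smul_right, norm_smul, mul_pow, Real.norm_eq_abs, sq_abs,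
      real_inner_comm (a - b)]
    ring
  have e2 : ⟪a - b, p⟫ = ⟪a - b, gradient F a - gradient F b⟫ - lam * ‖a - b‖ ^ 2 := by
    rw [hp, inner_sub_right, real_inner_smul_right, real_inner_self_eq_norm_sq]
  rw [e1, e2] at hfin
  linarith

end Convex

/-! ### Second moments of the uniform distribution on the sphere -/

instance instIsFiniteMeasureSphereUniform (d : ℕ) : IsFiniteMeasure (sphereUniform d) := by
  by_cases h : (volume : Measure (Vec d)).toSphere univ = 0
  · constructor
    simp only [sphereUniform, Measure.smul_apply, h, smul_zero]
    simp
  · exact ⟨by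
      rw [sphereUniform, Measure.smul_apply, smul_eq_mul,
        ENNReal.inv_mul_cancel h (measure_ne_top _ _)]
      exact ENNReal.one_lt_top⟩

lemma isProbabilityMeasure_sphereUniform {d : ℕ} (hd : 0 < d) :
    IsProbabilityMeasure (sphereUniform d) := by
  have : Nonempty (Fin d) := ⟨⟨0, hd⟩⟩
  have : Nontrivial (Vec d) := inferInstance
  refine ⟨?_⟩
  rw [sphereUniform, Measure.smul_apply, smul_eq_mul, ENNReal.inv_mul_cancel]
  · exact fun h => Measure.toSphere_ne_zero (volume : Measure (Vec d))
      (Measure.measure_univ_eq_zero.1 h)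
  · exact measure_ne_top _ _

/-- A linear isometry of the space, acting on the unit sphere. -/
noncomputable def sphereMap {d : ℕ} (U : Vec d ≃ₗᵢ[ℝ] Vec d) : Sph d ≃ᵐ Sph d where
  toFun z := ⟨U z, by simp⟩
  invFun z := ⟨U.symm z, by simp⟩
  left_inv z := by simp
  right_inv z := by simp
  measurable_toFun := ((U.continuous.comp continuous_subtype_val).subtype_mk _).measurable
  measurable_invFun := ((U.symm.continuous.comp continuous_subtype_val).subtype_mk _).measurable

@[simp]
lemma coe_sphereMap {d : ℕ} (U : Vec d ≃ₗᵢ[ℝ] Vec d) (z : Sph d) :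
    (sphereMap U z : Vec d) = U z := rfl

open scoped Pointwise in
lemma measurePreserving_sphereMap {d : ℕ} (U : Vec d ≃ₗᵢ[ℝ] Vec d) :
    MeasurePreserving (sphereMap U) (sphereUniform d) (sphereUniform d) := by
  have hU : Measurable (sphereMap U) := (sphereMap U).measurable
  refine ⟨hU, Measure.ext fun s hs => ?_⟩
  rw [Measure.map_apply hU hs, sphereUniform, Measure.smul_apply, Measure.smul_apply,
    Measure.toSphere_apply' _ hs, Measure.toSphere_apply' _ (hU hs)]
  have h1 : Ioo (0 : ℝ) 1 • ((↑) '' (sphereMap U ⁻¹' s) : Set (Vec d))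
      = U ⁻¹' (Ioo (0 : ℝ) 1 • ((↑) '' s : Set (Vec d))) := by
    ext x
    simp only [mem_smul, mem_image, mem_preimage]
    constructor
    · rintro ⟨r, hr, y, ⟨z, hz, rfl⟩, rfl⟩
      exact ⟨r, hr, U z, ⟨sphereMap U z, hz, coe_sphereMap U z⟩, by simp⟩
    · rintro ⟨r, hr, y, ⟨z, hz, rfl⟩, h⟩
      refine ⟨r, hr, U.symm z, ⟨sphereMap U.symm z, ?_, coe_sphereMap _ z⟩, ?_⟩
      · have : sphereMap U (sphereMap U.symm z) = z := Subtype.ext (by simp)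
        rwa [this]
      · rw [← map_smul, h, U.symm_apply_apply]
  rw [h1, ← U.coe_toMeasurableEquiv, U.measurePreserving.measure_preimage_equiv]

lemma integrable_sphere_of_continuous {d : ℕ} {g : Sph d → ℝ} (hg : Continuous g) :
    Integrable g (sphereUniform d) := by
  obtain ⟨c, hc⟩ := isCompact_univ.exists_bound_of_continuousOn hg.continuousOn
  exact Integrable.of_bound hg.aestronglyMeasurable c
    (Filter.Eventually.of_forall fun z => hc z (mem_univ z))

/-- By invariance under reflections, the second moment of a coordinate depends only on the length
of the coordinate vector, and the moments along an orthonormal basis add up to one. -/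
lemma integral_inner_sq_sphere {d : ℕ} (hd : 0 < d) (u : Vec d) :
    ∫ z : Sph d, ⟪u, (z : Vec d)⟫ ^ 2 ∂(sphereUniform d) = ‖u‖ ^ 2 / d := by
  have := isProbabilityMeasure_sphereUniform hd
  have hinv : ∀ u v : Vec d, ‖u‖ = ‖v‖ →
      ∫ z : Sph d, ⟪u, (z : Vec d)⟫ ^ 2 ∂(sphereUniform d)
        = ∫ z : Sph d, ⟪v, (z : Vec d)⟫ ^ 2 ∂(sphereUniform d) := by
    intro u v huv
    set R := (ℝ ∙ (u - v))ᗮ.reflection with hR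
    have hRu : R u = v := Submodule.reflection_sub huv
    have h1 := (measurePreserving_sphereMap R).integral_comp'
      (g := fun z : Sph d => ⟪v, (z : Vec d)⟫ ^ 2)
    rw [← h1]
    refine integral_congr_ae (Filter.Eventually.of_forall fun z => ?_)
    simp only [coe_sphereMap]
    rw [← hRu, R.inner_map_map]
  set e := EuclideanSpace.basisFun (Fin d) ℝ with he
  set q := ∫ z : Sph d, ⟪e ⟨0, hd⟩, (z : Vec d)⟫ ^ 2 ∂(sphereUniform d) with hq
  have hint : ∀ v : Vec d, Integrable (fun z : Sph d => ⟪v, (z : Vec d)⟫ ^ 2) (sphereUniform d) :=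
    fun v => integrable_sphere_of_continuous (by fun_prop)
  have hsum : (d : ℝ) * q = 1 := by
    have h1 : ∑ i, ∫ z : Sph d, ⟪e i, (z : Vec d)⟫ ^ 2 ∂(sphereUniform d) = d * q := by
      rw [Finset.sum_congr rfl fun i _ => hinv (e i) (e ⟨0, hd⟩) (by simp)]
      simp [hq]
    rw [← h1, ← integral_finsetSum _ fun i _ => hint (e i)]
    have h2 : ∀ z : Sph d, ∑ i, ⟪e i, (z : Vec d)⟫ ^ 2 = 1 := by
      intro z
      rw [e.sum_sq_inner_right]
      simp
    simp [h2]
  have hd' : (d : ℝ) ≠ 0 := by positivity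
  have hq' : q = 1 / d := by
    field_simp
    linarith
  have h3 := hinv u (‖u‖ • e ⟨0, hd⟩) (by simp [norm_smul])
  rw [h3]
  simp only [real_inner_smul_left, mul_pow]
  rw [integral_const_mul, ← hq, hq']
  ring

lemma integral_inner_mul_inner_sphere {d : ℕ} (hd : 0 < d) (u v : Vec d) :
    ∫ z : Sph d, ⟪u, (z : Vec d)⟫ * ⟪v, (z : Vec d)⟫ ∂(sphereUniform d) = ⟪u, v⟫ / d := by
  have hint : ∀ v : Vec d, Integrable (fun z : Sph d => ⟪v, (z : Vec d)⟫ ^ 2) (sphereUniform d) :=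
    fun v => integrable_sphere_of_continuous (by fun_prop)
  have h1 : ∀ z : Sph d, ⟪u, (z : Vec d)⟫ * ⟪v, (z : Vec d)⟫
      = (⟪u + v, (z : Vec d)⟫ ^ 2 - ⟪u - v, (z : Vec d)⟫ ^ 2) / 4 := by
    intro z
    rw [inner_add_left, inner_sub_left]
    ring
  simp only [h1]
  rw [integral_div, integral_sub (hint _) (hint _), integral_inner_sq_sphere hd,
    integral_inner_sq_sphere hd, norm_add_sq_real, norm_sub_sq_real]
  ring

/-! ### The trimmed mean -/

/-- The positions kept by the trimmed mean. -/
def keptPositions (m b : ℕ) : Finset (Fin m) :=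
  Finset.univ.filter fun i => b ≤ i.val ∧ i.val + b < m

lemma card_keptPositions (m b : ℕ) : (keptPositions m b).card = m - 2 * b := by
  have : (keptPositions m b).map Fin.valEmbedding = Finset.Ico b (m - b) := by
    ext j
    simp only [keptPositions, Finset.mem_map, Finset.mem_filter, Finset.mem_univ, true_and,
      Fin.valEmbedding_apply, Finset.mem_Ico]
    constructor
    · rintro ⟨i, hi, rfl⟩
      omega
    · intro hj
      exact ⟨⟨j, by omega⟩, ⟨hj.1, by simp only; omega⟩, rfl⟩
  rw [← Finset.card_map Fin.valEmbedding, this, Nat.card_Ico]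
  omega

/-- If at most `b` of the numbers are corrupted, every number that survives the trimming of `b`
numbers at each end lies between two uncorrupted ones. -/
lemma abs_sort_sub_le {m b : ℕ} (x : Fin m → ℝ) (B : Finset (Fin m)) (hB : B.card ≤ b) {c s : ℝ}
    (hx : ∀ i ∉ B, |x i - c| ≤ s) {i : Fin m} (hi : i ∈ keptPositions m b) :
    |x (Tuple.sort x i) - c| ≤ s := by
  simp only [keptPositions, Finset.mem_filter, Finset.mem_univ, true_and] at hi
  have hmono := Tuple.monotone_sort x
  -- a set of more than `b` positions contains one of an uncorrupted number
  have pick : ∀ S : Finset (Fin m), b < S.card → ∃ j ∈ S, Tuple.sort x j ∉ B := by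
    intro S hS
    by_contra! hcon
    have h1 : S.map (Tuple.sort x).toEmbedding ⊆ B := by
      intro j hj
      obtain ⟨l, hl, rfl⟩ := Finset.mem_map.1 hj
      exact hcon l hl
    have h2 := Finset.card_le_card h1
    rw [Finset.card_map] at h2
    omega
  obtain ⟨j, hj, hjB⟩ := pick (Finset.Iic i) (by rw [Fin.card_Iic]; omega)
  obtain ⟨l, hl, hlB⟩ := pick (Finset.Ici i) (by rw [Fin.card_Ici]; omega)
  have h1 := hmono (Finset.mem_Iic.1 hj)
  have h2 := hmono (Finset.mem_Ici.1 hl)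
  have h3 := (abs_le.1 (hx _ hjB)).1
  have h4 := (abs_le.1 (hx _ hlB)).2
  simp only [Function.comp_apply] at h1 h2
  rw [abs_le]
  constructor <;> linarith

/-- Robustness of the trimmed mean: the sum over the kept numbers differs from the sum over the
uncorrupted ones by at most `2 b` removed uncorrupted numbers and at most `b` kept corrupted
ones. -/
lemma abs_trimmedMean_sub_le {m : ℕ} {β : ℝ} (x : Fin m → ℝ) (B : Finset (Fin m))
    (hB : B.card ≤ ⌊β * m⌋₊) (hm : 2 * ⌊β * m⌋₊ < m) {c s S : ℝ}
    (hx : ∀ i ∉ B, |x i - c| ≤ s) (hS : |∑ i ∈ Bᶜ, (x i - c)| ≤ S) :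
    |trimmedMean β x - c| ≤ (S + 3 * ⌊β * m⌋₊ * s) / (m - 2 * ⌊β * m⌋₊) := by
  set b := ⌊β * m⌋₊ with hb
  set T : Finset (Fin m) := (keptPositions m b).map (Tuple.sort x).toEmbedding with hT
  have hTcard : T.card = m - 2 * b := by rw [hT, Finset.card_map, card_keptPositions]
  have hpos : (0 : ℝ) < m - 2 * b := by
    have : ((2 * b : ℕ) : ℝ) < m := by exact_mod_cast hm
    push_cast at this
    linarith
  have hTx : ∀ i ∈ T, |x i - c| ≤ s := by
    intro i hi
    obtain ⟨j, hj, rfl⟩ := Finset.mem_map.1 hi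
    exact abs_sort_sub_le x B hB hx hj
  have hcardR : (T.card : ℝ) = m - 2 * b := by
    rw [hTcard, Nat.cast_sub hm.le]
    push_cast
    rfl
  have htrim : trimmedMean β x - c = (∑ i ∈ T, (x i - c)) / (m - 2 * b) := by
    have : trimmedMean β x = (∑ i ∈ T, x i) / (m - 2 * b) := by
      rw [hT, Finset.sum_map]
      rfl
    rw [this, Finset.sum_sub_distrib, Finset.sum_const, nsmul_eq_mul, hcardR]
    field_simp
  have hs0 : 0 ≤ s := by
    have hne : T.Nonempty := by
      rw [← Finset.card_pos, hTcard]
      omega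
    obtain ⟨i, hi⟩ := hne
    exact (abs_nonneg _).trans (hTx i hi)
  have hsplit : ∑ i ∈ T, (x i - c) = ∑ i ∈ Bᶜ, (x i - c) - ∑ i ∈ Bᶜ \ T, (x i - c)
      + ∑ i ∈ T ∩ B, (x i - c) := by
    have h1 := Finset.sum_inter_add_sum_sdiff Bᶜ T (fun i => x i - c)
    have h2 := Finset.sum_inter_add_sum_sdiff T B (fun i => x i - c)
    have h3 : Bᶜ ∩ T = T \ B := by
      ext i
      simp [and_comm]
    rw [h3] at h1
    linarith
  have hbound : ∀ U : Finset (Fin m), (∀ i ∈ U, |x i - c| ≤ s) →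
      |∑ i ∈ U, (x i - c)| ≤ U.card * s := by
    intro U hU
    refine (Finset.abs_sum_le_sum_abs _ _).trans ((Finset.sum_le_sum hU).trans ?_)
    rw [Finset.sum_const, nsmul_eq_mul]
  have h1 : |∑ i ∈ Bᶜ \ T, (x i - c)| ≤ 2 * b * s := by
    refine (hbound _ fun i hi => hx i ?_).trans ?_
    · simp only [Finset.mem_sdiff, Finset.mem_compl] at hi
      exact hi.1
    · have : (Bᶜ \ T).card ≤ 2 * b := by
        have h2 : (Bᶜ \ T).card ≤ Tᶜ.card := by
          refine Finset.card_le_card fun i hi => ?_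
          simp only [Finset.mem_sdiff, Finset.mem_compl] at hi ⊢
          exact hi.2
        rw [Finset.card_compl, Fintype.card_fin, hTcard] at h2
        omega
      have : ((Bᶜ \ T).card : ℝ) ≤ 2 * b := by exact_mod_cast this
      gcongr
  have h2 : |∑ i ∈ T ∩ B, (x i - c)| ≤ b * s := by
    refine (hbound _ fun i hi => hTx i (Finset.mem_inter.1 hi).1).trans ?_
    have : (T ∩ B).card ≤ b := (Finset.card_le_card Finset.inter_subset_right).trans hB
    gcongr
  rw [htrim, abs_div, abs_of_pos hpos]
  gcongr
  rw [hsplit]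
  rw [abs_le] at *
  constructor <;> linarith [h1.1, h1.2, h2.1, h2.2, hS.1, hS.2]

lemma measurable_sort {m : ℕ} :
    @Measurable (Fin m → ℝ) (Equiv.Perm (Fin m)) _ ⊤ (fun x => Tuple.sort x) := by
  let : MeasurableSpace (Equiv.Perm (Fin m)) := ⊤
  refine measurable_to_countable' fun σ => ?_
  have : (fun x : Fin m → ℝ => Tuple.sort x) ⁻¹' {σ} =
      {x | (∀ i j, i ≤ j → x (σ i) ≤ x (σ j)) ∧
        ∀ i j, i < j → x (σ i) = x (σ j) → σ i < σ j} := by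
    ext x
    simp only [mem_preimage, mem_singleton_iff, mem_ofPred_eq]
    rw [eq_comm, Tuple.eq_sort_iff]
    rfl
  rw [this, ofPred_and]
  refine MeasurableSet.inter ?_ ?_
  · simp only [ofPred_forall]
    refine MeasurableSet.iInter fun i => MeasurableSet.iInter fun j =>
      MeasurableSet.iInter fun _ => measurableSet_le (measurable_pi_apply _) (measurable_pi_apply _)
  · have h : ∀ i j, MeasurableSet {x : Fin m → ℝ | x (σ i) = x (σ j)} := fun i j =>
      measurableSet_eq_fun (measurable_pi_apply _) (measurable_pi_apply _)
    simp only [ofPred_forall]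
    refine MeasurableSet.iInter fun i => MeasurableSet.iInter fun j =>
      MeasurableSet.iInter fun _ => ?_
    exact (h i j).imp (MeasurableSet.const _)

lemma measurable_trimmedMean {m : ℕ} (β : ℝ) :
    Measurable (trimmedMean β : (Fin m → ℝ) → ℝ) := by
  let : MeasurableSpace (Equiv.Perm (Fin m)) := ⊤
  refine Measurable.div_const (Finset.measurable_sum _ fun i _ => ?_) _
  have h : Measurable fun p : (Fin m → ℝ) × Equiv.Perm (Fin m) => p.1 (p.2 i) :=
    measurable_from_prod_countable_left fun σ => measurable_pi_apply (σ i)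
  exact h.comp (measurable_id.prodMk measurable_sort)

/-! ### Nets in Euclidean space -/

/-- The volume bound for the number of `δ`-separated points in a ball of radius `R`. -/
lemma card_le_of_separated {d : ℕ} {c : Vec d} {R δ : ℝ} (hδ : 0 < δ) (hR : 0 ≤ R)
    (S : Finset (Vec d)) (hS : ∀ x ∈ S, dist x c ≤ R)
    (hsep : ∀ x ∈ S, ∀ y ∈ S, x ≠ y → δ < dist x y) : (S.card : ℝ) ≤ (1 + 2 * R / δ) ^ d := by
  have hdisj : (S : Set (Vec d)).PairwiseDisjoint fun x => Metric.ball x (δ / 2) := by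
    intro x hx y hy hxy
    refine Metric.ball_disjoint_ball ?_
    linarith [hsep x hx y hy hxy]
  have hsub : ⋃ x ∈ S, Metric.ball x (δ / 2) ⊆ Metric.ball c (R + δ / 2) := by
    refine iUnion₂_subset fun x hx => Metric.ball_subset_ball' ?_
    linarith [hS x hx]
  have h1 := measure_mono (μ := (volume : Measure (Vec d))) hsub
  rw [measure_biUnion_finset hdisj fun _ _ => Metric.isOpen_ball.measurableSet] at h1
  have hv : ∀ (x : Vec d) {r : ℝ}, 0 < r → volume (Metric.ball x r)
      = ENNReal.ofReal (r ^ d) * volume (Metric.ball (0 : Vec d) 1) := fun x r hr => by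
    rw [Measure.addHaar_ball_of_pos _ x hr, finrank_euclideanSpace_fin]
  rw [Finset.sum_congr rfl fun x _ => hv x (half_pos hδ), hv c (by positivity), Finset.sum_const,
    nsmul_eq_mul, ← mul_assoc,
    ENNReal.mul_le_mul_iff_left (Metric.measure_ball_pos _ _ one_pos).ne' measure_ball_lt_top.ne,
    ← ENNReal.ofReal_natCast, ← ENNReal.ofReal_mul (by positivity),
    ENNReal.ofReal_le_ofReal_iff (by positivity), ← le_div_iff₀ (by positivity), ← div_pow] at h1
  have e : (R + δ / 2) / (δ / 2) = 1 + 2 * R / δ := by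
    field_simp
    ring
  rwa [e] at h1

/-- A maximal separated subset is a net. -/
lemma exists_net {d : ℕ} {A : Set (Vec d)} {c : Vec d} {R δ : ℝ} (hδ : 0 < δ) (hR : 0 ≤ R)
    (hA : ∀ x ∈ A, dist x c ≤ R) :
    ∃ S : Finset (Vec d), (∀ x ∈ S, x ∈ A) ∧ (∀ x ∈ A, ∃ y ∈ S, dist x y ≤ δ) ∧
      (S.card : ℝ) ≤ (1 + 2 * R / δ) ^ d := by
  classical
  let Q : ℕ → Prop := fun j => ∃ S : Finset (Vec d), S.card = j ∧ (∀ x ∈ S, x ∈ A) ∧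
    ∀ x ∈ S, ∀ y ∈ S, x ≠ y → δ < dist x y
  have hQ : ∀ j, Q j → (j : ℝ) ≤ (1 + 2 * R / δ) ^ d := by
    rintro j ⟨S, rfl, hSA, hsep⟩
    exact card_le_of_separated hδ hR S (fun x hx => hA x (hSA x hx)) hsep
  obtain ⟨N, hN⟩ := exists_nat_ge ((1 + 2 * R / δ) ^ d)
  have hQ0 : Q 0 := ⟨∅, by simp⟩
  have hmax := Nat.findGreatest_spec (P := Q) (Nat.zero_le N) hQ0
  obtain ⟨S, hcard, hSA, hsep⟩ := id hmax
  refine ⟨S, hSA, fun x hx => ?_, hcard ▸ hQ _ hmax⟩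
  by_contra! hcon
  have hxS : x ∉ S := fun h => by simpa using (hcon x h).trans' hδ
  have hQ1 : Q (S.card + 1) := by
    refine ⟨insert x S, Finset.card_insert_of_notMem hxS, fun y hy => ?_, fun y hy z hz hyz => ?_⟩
    · rcases Finset.mem_insert.1 hy with rfl | h
      exacts [hx, hSA y h]
    · rcases Finset.mem_insert.1 hy with rfl | hy' <;> rcases Finset.mem_insert.1 hz with rfl | hz'
      · exact absurd rfl hyz
      · exact hcon z hz'
      · rw [dist_comm]
        exact hcon y hy'
      · exact hsep y hy' z hz' hyz
  have hle : S.card + 1 ≤ N := by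
    have := (hQ _ hQ1).trans hN
    exact_mod_cast this
  have := Nat.le_findGreatest hle hQ1
  omega

/-- A net at the scale on which a `K`-Lipschitz function varies by at most `ρ`, with a bound for its
size in terms of any `κ ≥ K`. A single point serves if `κ = 0`. -/
lemma exists_net_lipschitz {d : ℕ} {A : Set (Vec d)} (hne : A.Nonempty) {R κ K ρ : ℝ}
    (hκ : 0 ≤ κ) (hρ : 0 < ρ) (hK : 0 ≤ K) (hKκ : K ≤ κ) (hR : 0 ≤ R)
    {c : Vec d} (hA : ∀ x ∈ A, dist x c ≤ R) :
    ∃ S : Finset (Vec d), (∀ x ∈ S, x ∈ A) ∧ (∀ x ∈ A, ∃ y ∈ S, K * dist x y ≤ ρ) ∧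
      (S.card : ℝ) ≤ (1 + 2 * R * κ / ρ) ^ d := by
  rcases hκ.eq_or_lt with h | h
  · obtain ⟨a, ha⟩ := hne
    have hK0 : K = 0 := le_antisymm (by linarith) hK
    refine ⟨{a}, by simpa using ha, fun x _ => ⟨a, by simp, ?_⟩, ?_⟩
    · simp [hK0, hρ.le]
    · simp [← h]
  · obtain ⟨S, h1, h2, h3⟩ := exists_net (div_pos hρ h) hR hA
    refine ⟨S, h1, fun x hx => ?_, h3.trans_eq ?_⟩
    · obtain ⟨y, hy, hxy⟩ := h2 x hx
      refine ⟨y, hy, ?_⟩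
      calc K * dist x y ≤ κ * (ρ / κ) := by gcongr
        _ = ρ := by field_simp
    · congr 2
      field_simp

/-! ### Concentration of sums of sub-exponential samples -/

section Concentration

variable {Γ : Type*} [MeasurableSpace Γ] {P : Measure Γ} [IsProbabilityMeasure P]

instance instIsProbabilityMeasureSamplesLaw (m n : ℕ) :
    IsProbabilityMeasure (samplesLaw P m n) := by
  unfold samplesLaw
  infer_instance

/-- The moment generating function of the sum over the samples of the clients in `A`. -/
lemma integral_exp_sum_samples {m n : ℕ} (A : Finset (Fin m)) {Y : Γ → ℝ} {l : ℝ}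
    (hY : Integrable (fun γ => Real.exp (l * Y γ)) P) :
    Integrable (fun s : Fin m → Fin n → Γ => Real.exp (l * ∑ i ∈ A, ∑ j, Y (s i j)))
      (samplesLaw P m n) ∧
    ∫ s : Fin m → Fin n → Γ, Real.exp (l * ∑ i ∈ A, ∑ j, Y (s i j)) ∂(samplesLaw P m n)
      = (∫ γ, Real.exp (l * Y γ) ∂P) ^ (A.card * n) := by
  classical
  let φ : Fin m → (Fin n → Γ) → ℝ := fun i x => if i ∈ A then ∏ j, Real.exp (l * Y (x j)) else 1
  have hφ : ∀ i, Integrable (φ i) (Measure.pi fun _ => P) := by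
    intro i
    by_cases hi : i ∈ A
    · simpa [φ, hi] using Integrable.fintype_prod (μ := fun _ : Fin n => P) (fun _ => hY)
    · simp [φ, hi]
  have hφint : ∀ i, ∫ x, φ i x ∂(Measure.pi fun _ : Fin n => P)
      = if i ∈ A then (∫ γ, Real.exp (l * Y γ) ∂P) ^ n else 1 := by
    intro i
    by_cases hi : i ∈ A
    · simp only [φ, hi, if_true]
      rw [integral_fintype_prod_eq_pow (fun γ => Real.exp (l * Y γ)), Fintype.card_fin]
    · simp [φ, hi]
  have hprod : ∀ s : Fin m → Fin n → Γ,
      Real.exp (l * ∑ i ∈ A, ∑ j, Y (s i j)) = ∏ i, φ i (s i) := by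
    intro s
    simp only [φ]
    rw [Finset.mul_sum, Real.exp_sum, Finset.prod_ite_mem, Finset.univ_inter]
    refine Finset.prod_congr rfl fun i _ => ?_
    rw [Finset.mul_sum, Real.exp_sum]
  simp only [hprod]
  refine ⟨Integrable.fintype_prod hφ, ?_⟩
  rw [samplesLaw, integral_fintype_prod_eq_prod]
  simp only [hφint]
  rw [Finset.prod_ite_mem, Finset.univ_inter, Finset.prod_const, ← pow_mul, mul_comm]

/-- The exponent at which the Chernoff bound for `N` samples is applied: the optimal one for a
Gaussian tail if it is at most `1 / (2 v)`, and `1 / (2 v)` otherwise. -/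
lemma exists_chernoff_exponent {v N x : ℝ} (hv : 0 < v) (hN : 0 < N) (hx : 0 ≤ x) :
    ∃ l : ℝ, 0 ≤ l ∧ l < 1 / v ∧
      N * (v ^ 2 * l ^ 2 / 2) - l * (v * √(2 * N * x) + 2 * v * x) ≤ -x := by
  set r := √(2 * x / N) with hr
  have hr0 : 0 ≤ r := Real.sqrt_nonneg _
  have hr2 : r ^ 2 * N = 2 * x := by
    rw [hr, Real.sq_sqrt (by positivity)]
    field_simp
  have hNr : √(2 * N * x) = N * r := by
    rw [Real.sqrt_eq_iff_mul_self_eq (by positivity) (by positivity)]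
    linear_combination -N * hr2
  rw [hNr]
  rcases le_or_gt r (1 / 2) with h | h
  · refine ⟨r / v, by positivity, by gcongr; linarith, ?_⟩
    have e : N * (v ^ 2 * (r / v) ^ 2 / 2) - r / v * (v * (N * r) + 2 * v * x)
        = -(r ^ 2 * N) / 2 - 2 * r * x := by
      field_simp
      ring
    rw [e, hr2]
    nlinarith [mul_nonneg hr0 hx]
  · refine ⟨1 / 2 / v, by positivity, by gcongr; norm_num, ?_⟩
    have e : N * (v ^ 2 * (1 / 2 / v) ^ 2 / 2) - 1 / 2 / v * (v * (N * r) + 2 * v * x)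
        = N / 8 - N * r / 2 - x := by
      field_simp
      ring
    rw [e]
    nlinarith

/-- Bernstein's inequality for the samples of the clients in `A`. -/
lemma measureReal_abs_sum_samples_ge {m n : ℕ} {A : Finset (Fin m)} (hA : A.Nonempty) (hn : 0 < n)
    {v x : ℝ} (hv : 0 < v) (hx : 0 ≤ x) {X : Γ → ℝ} (hX : IsSubExponential P v X) :
    (samplesLaw P m n).real {s | v * √(2 * (A.card * n) * x) + 2 * v * x
      ≤ |∑ i ∈ A, ∑ j, (X (s i j) - ∫ γ, X γ ∂P)|} ≤ 2 * Real.exp (-x) := by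
  set Q := samplesLaw P m n with hQ
  set Y : Γ → ℝ := fun γ => X γ - ∫ γ', X γ' ∂P with hY
  have hN : (0 : ℝ) < A.card * n := by
    have := hA.card_pos
    positivity
  obtain ⟨l, hl0, hl1, hl⟩ := exists_chernoff_exponent hv hN hx
  set S := v * √(2 * (A.card * n) * x) + 2 * v * x with hS
  have tail : ∀ l' : ℝ, |l'| = l →
      Q.real {s | Real.exp (l * S) ≤ Real.exp (l' * ∑ i ∈ A, ∑ j, Y (s i j))}
        ≤ Real.exp (-x) := by
    intro l' hl'
    obtain ⟨h1, h2⟩ := hX.2 l' (by rwa [hl'])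
    obtain ⟨h3, h4⟩ := integral_exp_sum_samples (n := n) A h1
    have h5 := mul_meas_ge_le_integral_of_nonneg
      (Filter.Eventually.of_forall fun s => (Real.exp_pos _).le) h3 (Real.exp (l * S))
    rw [h4] at h5
    have h6 : (∫ γ, Real.exp (l' * (X γ - ∫ γ', X γ' ∂P)) ∂P) ^ (A.card * n)
        ≤ Real.exp (A.card * n * (v ^ 2 * l ^ 2 / 2)) := by
      have e : Real.exp (A.card * n * (v ^ 2 * l ^ 2 / 2))
          = Real.exp (v ^ 2 * l' ^ 2 / 2) ^ (A.card * n) := by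
        rw [← Real.exp_nat_mul, ← hl', sq_abs]
        push_cast
        rfl
      rw [e]
      exact pow_le_pow_left₀ (integral_nonneg fun γ => (Real.exp_pos _).le) h2 _
    have h7 := h5.trans h6
    rw [← le_div_iff₀' (Real.exp_pos _), ← Real.exp_sub] at h7
    exact h7.trans (Real.exp_le_exp.2 hl)
  have hsub : {s : Fin m → Fin n → Γ | S ≤ |∑ i ∈ A, ∑ j, Y (s i j)|} ⊆
      {s | Real.exp (l * S) ≤ Real.exp (l * ∑ i ∈ A, ∑ j, Y (s i j))} ∪
      {s | Real.exp (l * S) ≤ Real.exp (-l * ∑ i ∈ A, ∑ j, Y (s i j))} := by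
    intro s hs
    rcases le_abs.1 (show S ≤ |∑ i ∈ A, ∑ j, Y (s i j)| from hs) with h | h
    · exact Or.inl (Real.exp_le_exp.2 (mul_le_mul_of_nonneg_left h hl0))
    · refine Or.inr (Real.exp_le_exp.2 ?_)
      rw [neg_mul, ← mul_neg]
      exact mul_le_mul_of_nonneg_left h hl0
  refine (measureReal_mono hsub).trans ((measureReal_union_le _ _).trans ?_)
  linarith [tail l (abs_of_nonneg hl0), tail (-l) (by rw [abs_neg, abs_of_nonneg hl0])]

/-- An event on which, for finitely many statistics, the sums over the samples of each client
outside `B` and the sum over all these clients are close to their expectations. The loss need not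
be measurable, only almost everywhere so: the event is the complement of a measurable hull. -/
lemma exists_event_finite {ι : Type*} (I : Finset ι) {m n : ℕ} {B : Finset (Fin m)}
    (hB : Bᶜ.Nonempty) (hn : 0 < n) {v x₀ x₁ : ℝ} (hv : 0 < v) (hx₀ : 0 ≤ x₀) (hx₁ : 0 ≤ x₁)
    {X : ι → Γ → ℝ} (hX : ∀ p ∈ I, IsSubExponential P v (X p)) :
    ∃ G : Set (Fin m → Fin n → Γ), MeasurableSet G ∧
      1 - I.card * (m * (2 * Real.exp (-x₁)) + 2 * Real.exp (-x₀)) ≤ (samplesLaw P m n).real G ∧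
      ∀ s ∈ G, ∀ p ∈ I,
        (∀ i ∉ B, |∑ j, (X p (s i j) - ∫ γ, X p γ ∂P)| ≤ v * √(2 * n * x₁) + 2 * v * x₁) ∧
        |∑ i ∈ Bᶜ, ∑ j, (X p (s i j) - ∫ γ, X p γ ∂P)|
          ≤ v * √(2 * (n * m) * x₀) + 2 * v * x₀ := by
  set Q := samplesLaw P m n with hQ
  let bad₁ : ι → Fin m → Set (Fin m → Fin n → Γ) := fun p i =>
    {s | v * √(2 * n * x₁) + 2 * v * x₁ ≤ |∑ j, (X p (s i j) - ∫ γ, X p γ ∂P)|}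
  let bad₀ : ι → Set (Fin m → Fin n → Γ) := fun p =>
    {s | v * √(2 * (n * m) * x₀) + 2 * v * x₀
      ≤ |∑ i ∈ Bᶜ, ∑ j, (X p (s i j) - ∫ γ, X p γ ∂P)|}
  let bad : Set (Fin m → Fin n → Γ) := ⋃ p ∈ I, (⋃ i ∈ Bᶜ, bad₁ p i) ∪ bad₀ p
  have h₁ : ∀ p ∈ I, ∀ i, Q.real (bad₁ p i) ≤ 2 * Real.exp (-x₁) := by
    intro p hp i
    simpa [bad₁, hQ] using
      measureReal_abs_sum_samples_ge (A := {i}) (by simp) hn hv hx₁ (hX p hp)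
  have hcard : (Bᶜ.card : ℝ) ≤ m := by
    have := Finset.card_le_univ Bᶜ
    rw [Fintype.card_fin] at this
    exact_mod_cast this
  have h₀ : ∀ p ∈ I, Q.real (bad₀ p) ≤ 2 * Real.exp (-x₀) := by
    intro p hp
    refine (measureReal_mono fun s hs => ?_).trans
      (measureReal_abs_sum_samples_ge hB hn hv hx₀ (hX p hp))
    refine le_trans ?_ (show v * √(2 * (n * m) * x₀) + 2 * v * x₀
      ≤ |∑ i ∈ Bᶜ, ∑ j, (X p (s i j) - ∫ γ, X p γ ∂P)| from hs)
    rw [mul_comm (n : ℝ)]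
    gcongr
  have hbad : Q.real bad ≤ I.card * (m * (2 * Real.exp (-x₁)) + 2 * Real.exp (-x₀)) := by
    refine (measureReal_biUnion_finset_le _ _).trans ?_
    rw [← nsmul_eq_mul, ← Finset.sum_const]
    refine Finset.sum_le_sum fun p hp => (measureReal_union_le _ _).trans ?_
    refine add_le_add ((measureReal_biUnion_finset_le _ _).trans ?_) (h₀ p hp)
    refine (Finset.sum_le_sum fun i _ => h₁ p hp i).trans ?_
    rw [Finset.sum_const, nsmul_eq_mul]
    gcongr
  refine ⟨(toMeasurable Q bad)ᶜ, (measurableSet_toMeasurable _ _).compl, ?_, ?_⟩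
  · rw [probReal_compl_eq_one_sub (measurableSet_toMeasurable _ _), measureReal_def,
      measure_toMeasurable, ← measureReal_def]
    linarith
  · intro s hs p hp
    have hs' : s ∉ bad := fun h => hs (subset_toMeasurable _ _ h)
    have hs₁ : ∀ i ∉ B, s ∉ bad₁ p i := fun i hi h => hs' <|
      mem_iUnion₂.2 ⟨p, hp, Or.inl (mem_iUnion₂.2 ⟨i, Finset.mem_compl.2 hi, h⟩)⟩
    have hs₀ : s ∉ bad₀ p := fun h => hs' (mem_iUnion₂.2 ⟨p, hp, Or.inr h⟩)
    exact ⟨fun i hi => (not_le.1 (hs₁ i hi)).le, (not_le.1 hs₀).le⟩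

end Concentration

/-! ### Uniform robustness of the trimmed mean of the clients' estimates -/

/-- The expectation `d (F(w + μ z) - F(w - μ z)) / (2 μ)` of the scalars `zoCoeff`. -/
noncomputable def meanCoeff {d : ℕ} (F : Vec d → ℝ) (μ : ℝ) (w z : Vec d) : ℝ :=
  d * ((F (w + μ • z) - F (w - μ • z)) / (2 * μ))

lemma integral_zoCoeff {d : ℕ} {Γ : Type*} [MeasurableSpace Γ] {P : Measure Γ}
    {f : Vec d → Γ → ℝ} (hf : ∀ w, Integrable (f w) P) (μ : ℝ) (w z : Vec d) :
    ∫ γ, zoCoeff f μ w z γ ∂P = meanCoeff (populationLoss P f) μ w z := by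
  simp only [zoCoeff, meanCoeff, populationLoss]
  rw [integral_const_mul, integral_div, integral_sub (hf _) (hf _)]

/-- The logarithm of the bound for the number of points of the net of `W × Sph d`, times the number
of clients, is `d * logFactor`. -/
lemma log_card_eq {d n m : ℕ} (hd : 0 < d) (hm : 0 < m) {L D : ℝ} (hL : 0 ≤ L) (hD : 0 ≤ D) :
    Real.log (((1 + 2 * n * m * L) ^ d * (1 + n * m * L * D) ^ d) * m)
      = d * logFactor d n m L D := by
  have h1 : (0 : ℝ) < 1 + 2 * n * m * L := by positivity
  have h2 : (0 : ℝ) < 1 + n * m * L * D := by positivity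
  have hm' : (0 : ℝ) < m := by positivity
  rw [Real.log_mul (by positivity) (by positivity), Real.log_mul (by positivity) (by positivity),
    Real.log_pow, Real.log_pow, logFactor]
  field_simp
  ring

lemma logFactor_nonneg {d n m : ℕ} (hm : 0 < m) {L D : ℝ} (hL : 0 ≤ L) (hD : 0 ≤ D) :
    0 ≤ logFactor d n m L D := by
  have h1 : (1 : ℝ) ≤ m := by exact_mod_cast hm
  have h2 : (0 : ℝ) ≤ n * m * L * D := by positivity
  have h3 : (0 : ℝ) ≤ 2 * n * m * L := by positivity
  have := Real.log_nonneg h1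
  have := Real.log_nonneg (show (1 : ℝ) ≤ 1 + n * m * L * D by linarith)
  have := Real.log_nonneg (show (1 : ℝ) ≤ 1 + 2 * n * m * L by linarith)
  unfold logFactor
  positivity

/-- The bound of `abs_trimmedMean_sub_le`, for the deviations given by Bernstein's inequality and
the nets, is at most the robustness error. -/
lemma robustness_bound_le {d n m b : ℕ} (hn : 0 < n) (hm : 0 < m) {v ε β L D x₀ x₁ : ℝ}
    (hv : 0 < v) (hε : 0 < ε) (hβ0 : 0 ≤ β) (hβ : β < 1 / 2 - ε) (hb : (b : ℝ) ≤ β * m)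
    (hΛ : 0 ≤ logFactor d n m L D)
    (hx₀ : x₀ ≤ 2 * (d * logFactor d n m L D)) (hx₁ : x₁ ≤ 2 * (d * logFactor d n m L D)) :
    (((v * √(2 * (n * m) * x₀) + 2 * v * x₀) / n + m * (6 / (n * m)))
      + 3 * b * ((v * √(2 * n * x₁) + 2 * v * x₁) / n + 6 / (n * m))) / (m - 2 * b)
      ≤ robustnessError 8 d n m v ε β L D := by
  have hn' : (0 : ℝ) < n := by positivity
  have hm' : (0 : ℝ) < m := by positivity
  rw [robustnessError]
  set Λ := logFactor d n m L D with hΛdef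
  have hsq : ∀ {a x : ℝ}, 0 < a → x ≤ 2 * (d * Λ) →
      √(2 * a * x) ≤ 2 * (√a * (√(d : ℝ) * √Λ)) := by
    intro a x ha hx
    refine Real.sqrt_le_iff.2 ⟨by positivity, ?_⟩
    have e : (2 * (√a * (√(d : ℝ) * √Λ))) ^ 2 = 2 * a * (2 * (d * Λ)) := by
      rw [mul_pow, mul_pow, mul_pow, Real.sq_sqrt ha.le, Real.sq_sqrt (by positivity),
        Real.sq_sqrt hΛ]
      ring
    rw [e]
    gcongr
  have hs₁ := hsq hn' hx₁
  have hs₀ := hsq (mul_pos hn' hm') hx₀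
  have hden : 2 * ε * m ≤ m - 2 * b := by nlinarith
  have hA₁ : (v * √(2 * n * x₁) + 2 * v * x₁) / n + 6 / (n * m)
      ≤ (v * (2 * (√n * (√(d : ℝ) * √Λ))) + 2 * v * (2 * (d * Λ))) / n + 6 / (n * m) := by
    gcongr
  have hA₀ : (v * √(2 * (n * m) * x₀) + 2 * v * x₀) / n + m * (6 / (n * m))
      ≤ (v * (2 * (√(n * m) * (√(d : ℝ) * √Λ))) + 2 * v * (2 * (d * Λ))) / n
        + m * (6 / (n * m)) := by
    gcongr
  set A₁ := (v * (2 * (√n * (√(d : ℝ) * √Λ))) + 2 * v * (2 * (d * Λ))) / n + 6 / (n * m)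
  set A₀ := (v * (2 * (√(n * m) * (√(d : ℝ) * √Λ))) + 2 * v * (2 * (d * Λ))) / n
        + m * (6 / (n * m))
  have hA₁0 : 0 ≤ A₁ := by positivity
  have hA₀0 : 0 ≤ A₀ := by positivity
  have step : (((v * √(2 * (n * m) * x₀) + 2 * v * x₀) / n + m * (6 / (n * m)))
      + 3 * b * ((v * √(2 * n * x₁) + 2 * v * x₁) / n + 6 / (n * m))) / (m - 2 * b)
      ≤ (A₀ + 3 * (β * m) * A₁) / (2 * ε * m) := by
    refine div_le_div₀ (by positivity) ?_ (by positivity) hden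
    refine add_le_add hA₀ ?_
    calc 3 * b * ((v * √(2 * n * x₁) + 2 * v * x₁) / n + 6 / (n * m)) ≤ 3 * b * A₁ := by gcongr
      _ ≤ 3 * (β * m) * A₁ := by gcongr
  refine step.trans ?_
  have hsn : √(n : ℝ) / n = 1 / √(n : ℝ) := by
    rw [div_eq_div_iff (by positivity) (by positivity), Real.mul_self_sqrt hn'.le, one_mul]
  have hsnm : √((n : ℝ) * m) / (n * m) = 1 / √((n : ℝ) * m) := by
    rw [div_eq_div_iff (by positivity) (by positivity), Real.mul_self_sqrt (by positivity), one_mul]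
  have e : (A₀ + 3 * (β * m) * A₁) / (2 * ε * m)
      = √Λ * (v * √(d : ℝ) / ε) * (3 * β * (√(n : ℝ) / n) + √((n : ℝ) * m) / (n * m))
        + v * (d * Λ) / ε * (6 * (β / n) + 2 * (1 / (m * n)))
        + (3 * (1 + 3 * β) / ε) * (1 / (m * n)) := by
    simp only [A₀, A₁]
    field_simp
    ring
  rw [e, hsn, hsnm]
  have h1 : √Λ * (v * √(d : ℝ) / ε) * (3 * β * (1 / √(n : ℝ)) + 1 / √((n : ℝ) * m))
      ≤ √Λ * (v * √(d : ℝ) / ε) * (3 * β / √(n : ℝ) + √2 / √((n : ℝ) * m)) := by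
    rw [mul_one_div]
    have : (1 : ℝ) ≤ √2 := Real.one_le_sqrt.2 (by norm_num)
    gcongr
  have h2 : v * (d * Λ) / ε * (6 * (β / n) + 2 * (1 / (m * n)))
      ≤ v * (d * Λ) / ε * (8 * (β / n + 1 / (m * n))) := by
    have : 0 ≤ β / n := by positivity
    have : (0 : ℝ) ≤ 1 / (m * n) := by positivity
    gcongr
    linarith
  have h3 : (3 * (1 + 3 * β) / ε) * (1 / (m * n)) ≤ 8 / ε * (β / n + 1 / (m * n)) := by
    have h4 : 0 ≤ β / n := by positivity
    calc (3 * (1 + 3 * β) / ε) * (1 / ((m : ℝ) * n)) ≤ 8 / ε * (1 / (m * n)) := by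
          gcongr
          linarith
      _ ≤ _ := by gcongr; linarith
  have e2 : 8 * ((1 + v * d * Λ) / ε) * (β / n + 1 / (m * n))
      = v * (d * Λ) / ε * (8 * (β / n + 1 / (m * n))) + 8 / ε * (β / n + 1 / (m * n)) := by
    ring
  rw [e2]
  linarith

/-- Uniform robustness: outside an event of small probability, for all `w ∈ W`, all directions and
all values sent by the Byzantine clients, the trimmed mean is within the robustness error of
`meanCoeff`. The deviations are controlled at the points of a net of `W × Sph d`; between these
points the Lipschitz conditions apply. -/
lemma exists_event_robust {Γ : Type*} [MeasurableSpace Γ] {P : Measure Γ} [IsProbabilityMeasure P]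
    {d m n : ℕ} (hd : 0 < d) (hm : 0 < m) (hn : 0 < n) {f : Vec d → Γ → ℝ}
    (hf : ∀ w, Integrable (f w) P) {W : Set (Vec d)} (hW : W.Nonempty)
    (hWb : Bornology.IsBounded W) {μ : ℝ} {Lw Lz : ℝ≥0}
    (hLw : ∀ γ, ∀ z ∈ Metric.sphere (0 : Vec d) 1,
      LipschitzOnWith Lw (fun w => zoCoeff f μ w z γ) W)
    (hLz : ∀ γ, ∀ w ∈ W, LipschitzOnWith Lz (fun z => zoCoeff f μ w z γ) (Metric.sphere 0 1))
    {v : ℝ} (hv : 0 < v)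
    (hX : ∀ w ∈ W, ∀ z ∈ Metric.sphere (0 : Vec d) 1, IsSubExponential P v (zoCoeff f μ w z))
    {B : Finset (Fin m)} {α β ε : ℝ} (hα : (B.card : ℝ) = α * m) (hε : 0 < ε) (hαβ : α ≤ β)
    (hβ : β < 1 / 2 - ε) :
    ∃ G : Set (Fin m → Fin n → Γ), MeasurableSet G ∧
      1 - failureProb d n m (Lw + Lz) (Metric.diam W) ≤ (samplesLaw P m n).real G ∧
      ∀ s ∈ G, ∀ w ∈ W, ∀ z ∈ Metric.sphere (0 : Vec d) 1, ∀ a : Fin m → ℝ,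
        |trimmedMean β (messages f μ B s w z a) - meanCoeff (populationLoss P f) μ w z|
          ≤ robustnessError 8 d n m v ε β (Lw + Lz) (Metric.diam W) := by
  have hn' : (0 : ℝ) < n := by positivity
  have hm' : (0 : ℝ) < m := by positivity
  have hm1 : (1 : ℝ) ≤ m := by exact_mod_cast hm
  set D := Metric.diam W with hD
  have hD0 : 0 ≤ D := Metric.diam_nonneg
  have hL0 : (0 : ℝ) ≤ Lw + Lz := by positivity
  have hβ0 : 0 ≤ β := by
    have h : (0 : ℝ) ≤ α * m := hα ▸ Nat.cast_nonneg _
    exact (nonneg_of_mul_nonneg_left h hm').trans hαβ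
  set b := ⌊β * m⌋₊ with hb
  have hbR : (b : ℝ) ≤ β * m := Nat.floor_le (by positivity)
  have hBb : B.card ≤ b := Nat.le_floor (by rw [hα]; gcongr)
  have hb2 : 2 * b < m := by
    have : (2 * b : ℝ) < m := by nlinarith
    exact_mod_cast this
  have hBc : Bᶜ.Nonempty := by
    rw [← Finset.card_pos, Finset.card_compl, Fintype.card_fin]
    omega
  have hne : (Metric.sphere (0 : Vec d) 1).Nonempty := by
    have : Nonempty (Fin d) := ⟨⟨0, hd⟩⟩
    exact NormedSpace.sphere_nonempty.2 zero_le_one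
  obtain ⟨w₀, hw₀⟩ := hW
  obtain ⟨Sw, hSw, hSwnet, hSwcard⟩ := exists_net_lipschitz (A := W) ⟨w₀, hw₀⟩ hL0
    (show (0 : ℝ) < 2 / (n * m) by positivity) Lw.coe_nonneg (le_add_of_nonneg_right Lz.coe_nonneg) hD0
    (fun x hx => Metric.dist_le_diam_of_mem hWb hx hw₀)
  obtain ⟨Sz, hSz, hSznet, hSzcard⟩ := exists_net_lipschitz hne hL0
    (show (0 : ℝ) < 1 / (n * m) by positivity) Lz.coe_nonneg (le_add_of_nonneg_left Lw.coe_nonneg) zero_le_one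
    (fun x hx => (Metric.mem_sphere.1 hx).le)
  have ew : 1 + 2 * D * (Lw + Lz) / (2 / (n * m)) = 1 + n * m * (Lw + Lz) * D := by
    field_simp
  have ez : 1 + 2 * 1 * (Lw + Lz) / (1 / ((n : ℝ) * m)) = 1 + 2 * n * m * (Lw + Lz) := by
    field_simp
  rw [ew] at hSwcard
  rw [ez] at hSzcard
  set M : ℝ := (1 + 2 * n * m * (Lw + Lz)) ^ d * (1 + n * m * (Lw + Lz) * D) ^ d with hM
  have hM1 : 1 ≤ M := by
    refine one_le_mul_of_one_le_of_one_le (one_le_pow₀ ?_) (one_le_pow₀ ?_)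
    · linarith [show (0 : ℝ) ≤ 2 * n * m * (Lw + Lz) by positivity]
    · linarith [show (0 : ℝ) ≤ n * m * (Lw + Lz) * D by positivity]
  have hM0 : 0 < M := by linarith
  have hlog := log_card_eq (n := n) hd hm hL0 hD0
  rw [← hM, Real.log_mul hM0.ne' hm'.ne'] at hlog
  have hlogM : 0 ≤ Real.log M := Real.log_nonneg hM1
  have hlogm : 0 ≤ Real.log m := Real.log_nonneg hm1
  -- with these exponents each net point contributes failure probability `4 / M ^ 2`
  obtain ⟨G, hG, hGP, hGs⟩ := exists_event_finite (P := P) (n := n) (Sw ×ˢ Sz) hBc hn hv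
    (x₀ := 2 * Real.log M) (x₁ := Real.log m + 2 * Real.log M) (by positivity) (by positivity)
    (X := fun p => zoCoeff f μ p.1 p.2) (fun p hp => hX _ (hSw _ (Finset.mem_product.1 hp).1) _
      (hSz _ (Finset.mem_product.1 hp).2))
  refine ⟨G, hG, le_trans ?_ hGP, ?_⟩
  · have h1 : Real.exp (-(2 * Real.log M)) = 1 / M ^ 2 := by
      rw [Real.exp_neg, two_mul, Real.exp_add, Real.exp_log hM0]
      field_simp
    have h2 : Real.exp (-(Real.log m + 2 * Real.log M)) = 1 / (m * M ^ 2) := by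
      rw [neg_add, Real.exp_add, h1, Real.exp_neg, Real.exp_log hm']
      field_simp
    rw [h1, h2, failureProb, ← hM]
    have h3 : (((Sw ×ˢ Sz).card : ℕ) : ℝ) ≤ M := by
      rw [Finset.card_product, hM, Nat.cast_mul, mul_comm]
      gcongr
    have h4 : (((Sw ×ˢ Sz).card : ℕ) : ℝ) * (m * (2 * (1 / (m * M ^ 2))) + 2 * (1 / M ^ 2))
        ≤ M * (m * (2 * (1 / (m * M ^ 2))) + 2 * (1 / M ^ 2)) := by gcongr
    have h5 : M * (m * (2 * (1 / (m * M ^ 2))) + 2 * (1 / M ^ 2)) = 4 / M := by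
      field_simp
      norm_num
    linarith
  · intro s hs w hw z hz a
    obtain ⟨w', hw', hww'⟩ := hSwnet w hw
    obtain ⟨z', hz', hzz'⟩ := hSznet z hz
    obtain ⟨hd₁, hd₀⟩ := hGs s hs (w', z') (Finset.mem_product.2 ⟨hw', hz'⟩)
    simp only at hd₁ hd₀
    have hclose : ∀ γ, |zoCoeff f μ w z γ - zoCoeff f μ w' z' γ| ≤ 3 / (n * m) := by
      intro γ
      have h1 := (hLw γ z hz).dist_le_mul w hw w' (hSw _ hw')
      have h2 := (hLz γ w' (hSw _ hw')).dist_le_mul z hz z' (hSz _ hz')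
      rw [← Real.dist_eq]
      calc dist (zoCoeff f μ w z γ) (zoCoeff f μ w' z' γ)
          ≤ _ := dist_triangle _ (zoCoeff f μ w' z γ) _
        _ ≤ 2 / (n * m) + 1 / (n * m) := add_le_add (h1.trans hww') (h2.trans hzz')
        _ = 3 / (n * m) := by ring
    have hi := (hX w hw z hz).1
    have hi' := (hX w' (hSw _ hw') z' (hSz _ hz')).1
    have hcloseE : |∫ γ, zoCoeff f μ w z γ ∂P - ∫ γ, zoCoeff f μ w' z' γ ∂P| ≤ 3 / (n * m) := by
      rw [← integral_sub hi hi']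
      have := norm_integral_le_of_norm_le_const (μ := P)
        (f := fun γ => zoCoeff f μ w z γ - zoCoeff f μ w' z' γ) (Filter.Eventually.of_forall hclose)
      simpa using this
    rw [← integral_zoCoeff hf]
    set c := ∫ γ, zoCoeff f μ w z γ ∂P with hc
    set c' := ∫ γ, zoCoeff f μ w' z' γ ∂P with hc'
    have hclient : ∀ i ∉ B, messages f μ B s w z a i - c
        = (∑ j, (zoCoeff f μ w z (s i j) - c)) / n := by
      intro i hi
      rw [messages, if_neg hi, clientCoeff, Finset.sum_sub_distrib, Finset.sum_const,
        Finset.card_univ, Fintype.card_fin, nsmul_eq_mul]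
      field_simp
    have hdev : ∀ i, |∑ j, (zoCoeff f μ w z (s i j) - c) - ∑ j, (zoCoeff f μ w' z' (s i j) - c')|
        ≤ n * (6 / (n * m)) := by
      intro i
      rw [← Finset.sum_sub_distrib]
      refine (Finset.abs_sum_le_sum_abs _ _).trans
        ((Finset.sum_le_sum (g := fun _ => 6 / ((n : ℝ) * m)) fun j _ => ?_).trans_eq ?_)
      · have h1 := abs_le.1 (hclose (s i j))
        have h2 := abs_le.1 hcloseE
        have h3 : 6 / ((n : ℝ) * m) = 3 / (n * m) + 3 / (n * m) := by ring
        rw [h3, abs_le]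
        constructor <;> linarith [h1.1, h1.2, h2.1, h2.2]
      · simp
    refine (abs_trimmedMean_sub_le _ B hBb hb2
      (s := (v * √(2 * n * (Real.log m + 2 * Real.log M))
        + 2 * v * (Real.log m + 2 * Real.log M)) / n + 6 / (n * m))
      (S := (v * √(2 * (n * m) * (2 * Real.log M)) + 2 * v * (2 * Real.log M)) / n
        + m * (6 / (n * m))) ?_ ?_).trans
      (robustness_bound_le hn hm hv hε hβ0 hβ hbR (logFactor_nonneg hm hL0 hD0) ?_ ?_)
    · intro i hi
      rw [hclient i hi, abs_div, abs_of_pos hn', div_le_iff₀ hn', add_mul, div_mul_cancel₀ _ hn'.ne']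
      have h1 := abs_le.1 (hd₁ i hi)
      have h2 := abs_le.1 (hdev i)
      rw [abs_le]
      constructor <;> linarith [h1.1, h1.2, h2.1, h2.2]
    · rw [Finset.sum_congr rfl fun i hi => hclient i (Finset.mem_compl.1 hi), ← Finset.sum_div,
        abs_div, abs_of_pos hn', div_le_iff₀ hn', add_mul, div_mul_cancel₀ _ hn'.ne']
      have h1 := abs_le.1 hd₀
      have h2 : |∑ i ∈ Bᶜ, (∑ j, (zoCoeff f μ w z (s i j) - c)
          - ∑ j, (zoCoeff f μ w' z' (s i j) - c'))| ≤ m * (n * (6 / (n * m))) := by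
        refine (Finset.abs_sum_le_sum_abs _ _).trans
          ((Finset.sum_le_sum fun i _ => hdev i).trans ?_)
        rw [Finset.sum_const, nsmul_eq_mul]
        have : (Bᶜ.card : ℝ) ≤ m := by
          have := Finset.card_le_univ Bᶜ
          rw [Fintype.card_fin] at this
          exact_mod_cast this
        gcongr
      rw [Finset.sum_sub_distrib] at h2
      have h3 := abs_le.1 h2
      rw [abs_le]
      constructor <;> linarith [h1.1, h1.2, h3.1, h3.2]
    · linarith
    · linarith

/-! ### The Euclidean projection -/

section Projection

variable {d : ℕ} {W : Set (Vec d)}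

lemma euclideanProj_spec (hne : W.Nonempty) (hW : IsCompact W) (x : Vec d) :
    euclideanProj W x ∈ W ∧ ∀ q ∈ W, ‖euclideanProj W x - x‖ ^ 2 ≤ ‖q - x‖ ^ 2 := by
  have h : ∃ p, p ∈ W ∧ ∀ q ∈ W, ‖p - x‖ ^ 2 ≤ ‖q - x‖ ^ 2 := by
    obtain ⟨p, hp, hmin⟩ := hW.exists_isMinOn hne
      (f := fun p => ‖p - x‖ ^ 2) (by fun_prop)
    exact ⟨p, hp, fun q hq => hmin hq⟩
  exact Classical.epsilon_spec h

lemma euclideanProj_mem (hne : W.Nonempty) (hW : IsCompact W) (x : Vec d) :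
    euclideanProj W x ∈ W := (euclideanProj_spec hne hW x).1

lemma euclideanProj_of_mem (hW : IsCompact W) {x : Vec d} (hx : x ∈ W) :
    euclideanProj W x = x := by
  have h := (euclideanProj_spec ⟨x, hx⟩ hW x).2 x hx
  rw [sub_self, norm_zero] at h
  have h0 : ‖euclideanProj W x - x‖ = 0 := by
    have := norm_nonneg (euclideanProj W x - x)
    nlinarith
  exact sub_eq_zero.1 (norm_eq_zero.1 h0)

lemma inner_sub_euclideanProj_le (hc : Convex ℝ W) (hW : IsCompact W) (x : Vec d) {q : Vec d}
    (hq : q ∈ W) : ⟪x - euclideanProj W x, q - euclideanProj W x⟫ ≤ 0 := by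
  have hne : W.Nonempty := ⟨q, hq⟩
  obtain ⟨hp, hmin⟩ := euclideanProj_spec hne hW x
  refine (norm_eq_iInf_iff_real_inner_le_zero hc hp).1 ?_ q hq
  have : Nonempty W := hne.to_subtype
  refine le_antisymm (le_ciInf fun y => ?_) (ciInf_le ⟨0, ?_⟩ (⟨_, hp⟩ : W))
  · have h := hmin y y.2
    rw [norm_sub_rev, norm_sub_rev (y : Vec d)] at h
    exact le_of_sq_le_sq h (norm_nonneg _)
  · rintro _ ⟨y, rfl⟩
    exact norm_nonneg _

/-- The projection on a compact convex set does not increase distances. -/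
lemma lipschitzWith_euclideanProj (hne : W.Nonempty) (hc : Convex ℝ W) (hW : IsCompact W) :
    LipschitzWith 1 (euclideanProj W) := by
  refine LipschitzWith.of_dist_le_mul fun x y => ?_
  rw [NNReal.coe_one, one_mul, dist_eq_norm, dist_eq_norm]
  set p := euclideanProj W x with hp
  set q := euclideanProj W y with hq
  have h1 := inner_sub_euclideanProj_le hc hW x (euclideanProj_mem hne hW y)
  have h2 := inner_sub_euclideanProj_le hc hW y (euclideanProj_mem hne hW x)
  rw [← hp, ← hq] at h1 h2
  have h3 : ‖p - q‖ ^ 2 = ⟪x - y, p - q⟫ + (⟪x - p, q - p⟫ + ⟪y - q, p - q⟫) := by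
    rw [← neg_sub p q, inner_neg_right, ← real_inner_self_eq_norm_sq]
    simp only [inner_sub_left]
    ring
  have h4 := real_inner_le_norm (x - y) (p - q)
  rcases (norm_nonneg (p - q)).eq_or_lt with h | h
  · rw [← h]
    exact norm_nonneg _
  · refine le_of_mul_le_mul_right ?_ h
    nlinarith

end Projection

/-! ### The random linear map given by the directions of one round -/

/-- The law of the `k` directions of one round. -/
noncomputable abbrev roundLaw (d k : ℕ) : Measure (Fin k → Sph d) :=
  Measure.pi fun _ => sphereUniform d

/-- The average `(1 / k) ∑_r d ⟨y, z_r⟩ z_r`: the zero-order estimate, from exact directional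
derivatives, of a gradient `y`. -/
noncomputable def sketch {d k : ℕ} (z : Fin k → Sph d) (y : Vec d) : Vec d :=
  (1 / k : ℝ) • ∑ r, (d * ⟪y, (z r : Vec d)⟫) • (z r : Vec d)

lemma sketch_sub {d k : ℕ} (z : Fin k → Sph d) (x y : Vec d) :
    sketch z (x - y) = sketch z x - sketch z y := by
  simp only [sketch, inner_sub_left, mul_sub, sub_smul, Finset.sum_sub_distrib, smul_sub]

lemma continuous_sketch {d k : ℕ} :
    Continuous fun p : (Fin k → Sph d) × Vec d => sketch p.1 p.2 := by
  unfold sketch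
  fun_prop

lemma continuous_sketch_left {d k : ℕ} (y : Vec d) :
    Continuous fun z : Fin k → Sph d => sketch z y := by
  unfold sketch
  fun_prop

/-- The average over the directions of vectors `c_r z_r` has norm at most `max |c_r|`. -/
lemma norm_average_smul_sphere_le {d k : ℕ} {c : Fin k → ℝ} {C : ℝ} (hk : 0 < k)
    (z : Fin k → Sph d) (hc : ∀ r, |c r| ≤ C) :
    ‖(1 / k : ℝ) • ∑ r, c r • (z r : Vec d)‖ ≤ C := by
  have hk' : (0 : ℝ) < k := by positivity
  rw [norm_smul, Real.norm_of_nonneg (by positivity), one_div, inv_mul_le_iff₀ hk']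
  refine (norm_sum_le _ _).trans ((Finset.sum_le_sum (g := fun _ => C) fun r _ => ?_).trans_eq ?_)
  · rw [norm_smul, norm_eq_of_mem_sphere, mul_one]
    exact hc r
  · simp

lemma norm_sketch_le {d k : ℕ} (hk : 0 < k) (z : Fin k → Sph d) (y : Vec d) :
    ‖sketch z y‖ ≤ d * ‖y‖ := by
  refine norm_average_smul_sphere_le hk z fun r => ?_
  rw [abs_mul, Nat.abs_cast]
  gcongr
  simpa using abs_real_inner_le_norm y (z r : Vec d)

section Moments

variable {d k : ℕ}

lemma integrable_roundLaw_of_continuous {g : (Fin k → Sph d) → ℝ} (hg : Continuous g) :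
    Integrable g (roundLaw d k) := by
  obtain ⟨c, hc⟩ := isCompact_univ.exists_bound_of_continuousOn hg.continuousOn
  exact Integrable.of_bound hg.aestronglyMeasurable c
    (Filter.Eventually.of_forall fun z => hc z (mem_univ z))

lemma integral_roundLaw_eval (hd : 0 < d) (r : Fin k) {g : Sph d → ℝ} (hg : Continuous g) :
    ∫ z, g (z r) ∂(roundLaw d k) = ∫ z, g z ∂(sphereUniform d) := by
  have := isProbabilityMeasure_sphereUniform hd
  exact integral_comp_eval (μ := fun _ : Fin k => sphereUniform d) hg.aestronglyMeasurable

lemma integral_roundLaw_mul (hd : 0 < d) {r s : Fin k} (hrs : r ≠ s) {g h : Sph d → ℝ}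
    (hg : Continuous g) (hh : Continuous h) :
    ∫ z, g (z r) * h (z s) ∂(roundLaw d k)
      = (∫ z, g z ∂(sphereUniform d)) * ∫ z, h z ∂(sphereUniform d) := by
  have := isProbabilityMeasure_sphereUniform hd
  have hind := (ProbabilityTheory.iIndepFun_pi (μ := fun _ : Fin k => sphereUniform d)
    (X := fun _ z => z) (fun _ => aemeasurable_id)).indepFun hrs
  have h1 := (hind.comp hg.measurable hh.measurable).integral_mul_eq_mul_integral
    (hg.comp (continuous_apply r)).aestronglyMeasurable
    (hh.comp (continuous_apply s)).aestronglyMeasurable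
  rw [← integral_roundLaw_eval hd r hg, ← integral_roundLaw_eval hd s hh]
  exact h1

lemma integral_inner_sketch (hd : 0 < d) (hk : 0 < k) (x y : Vec d) :
    ∫ z : Fin k → Sph d, ⟪x, sketch z y⟫ ∂(roundLaw d k) = ⟪x, y⟫ := by
  have hd' : (0 : ℝ) < d := by positivity
  have hk' : (0 : ℝ) < k := by positivity
  have h1 : ∀ z : Fin k → Sph d, ⟪x, sketch z y⟫
      = (1 / k : ℝ) * ∑ r, d * (⟪x, (z r : Vec d)⟫ * ⟪y, (z r : Vec d)⟫) := by
    intro z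
    rw [sketch, real_inner_smul_right, inner_sum]
    congr 1
    refine Finset.sum_congr rfl fun r _ => ?_
    rw [real_inner_smul_right]
    ring
  simp only [h1]
  rw [integral_const_mul, integral_finsetSum _ fun r _ =>
    integrable_roundLaw_of_continuous (by fun_prop)]
  have h2 : ∀ r : Fin k, ∫ z : Fin k → Sph d, d * (⟪x, (z r : Vec d)⟫ * ⟪y, (z r : Vec d)⟫)
      ∂(roundLaw d k) = ⟪x, y⟫ := by
    intro r
    rw [integral_const_mul, integral_roundLaw_eval hd r
      (g := fun z => ⟪x, (z : Vec d)⟫ * ⟪y, (z : Vec d)⟫) (by fun_prop),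
      integral_inner_mul_inner_sphere hd]
    field_simp
  simp only [h2]
  simp
  field_simp

/-- The second moment of the sketch: the `k` diagonal terms contribute `d ‖y‖²` each, the
`k (k - 1)` terms of independent directions `‖y‖²` each. -/
lemma integral_norm_sketch_sq (hd : 0 < d) (hk : 0 < k) (y : Vec d) :
    ∫ z : Fin k → Sph d, ‖sketch z y‖ ^ 2 ∂(roundLaw d k)
      = ((d : ℝ) + k - 1) / k * ‖y‖ ^ 2 := by
  have hd' : (0 : ℝ) < d := by positivity
  have hk' : (0 : ℝ) < k := by positivity
  set e := EuclideanSpace.basisFun (Fin d) ℝ with he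
  let c : Fin k → Fin k → (Fin k → Sph d) → ℝ := fun r s z =>
    ⟪y, (z r : Vec d)⟫ * ⟪y, (z s : Vec d)⟫ * ⟪(z r : Vec d), (z s : Vec d)⟫
  have hcint : ∀ r s, Integrable (c r s) (roundLaw d k) := fun r s =>
    integrable_roundLaw_of_continuous (by fun_prop)
  have h1 : ∀ z : Fin k → Sph d, ‖sketch z y‖ ^ 2
      = (d ^ 2 / k ^ 2 : ℝ) * ∑ r, ∑ s, c r s z := by
    intro z
    have hs : sketch z y = (d / k : ℝ) • ∑ r, ⟪y, (z r : Vec d)⟫ • (z r : Vec d) := by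
      rw [sketch, Finset.smul_sum, Finset.smul_sum]
      refine Finset.sum_congr rfl fun r _ => ?_
      rw [smul_smul, smul_smul]
      congr 1
      ring
    rw [hs, norm_smul, mul_pow, Real.norm_eq_abs, sq_abs, div_pow, ← real_inner_self_eq_norm_sq,
      sum_inner]
    congr 1
    refine Finset.sum_congr rfl fun r _ => ?_
    rw [inner_sum]
    refine Finset.sum_congr rfl fun s _ => ?_
    rw [real_inner_smul_left, real_inner_smul_right]
    simp only [c]
    ring
  have hdiag : ∀ r, ∫ z, c r r z ∂(roundLaw d k) = ‖y‖ ^ 2 / d := by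
    intro r
    have h2 : ∀ z : Fin k → Sph d, c r r z = ⟪y, (z r : Vec d)⟫ ^ 2 := by
      intro z
      simp only [c]
      rw [real_inner_self_eq_norm_sq, norm_eq_of_mem_sphere]
      ring
    simp only [h2]
    rw [integral_roundLaw_eval hd r (g := fun z => ⟪y, (z : Vec d)⟫ ^ 2) (by fun_prop),
      integral_inner_sq_sphere hd]
  have hoff : ∀ r s, r ≠ s → ∫ z, c r s z ∂(roundLaw d k) = ‖y‖ ^ 2 / d ^ 2 := by
    intro r s hrs
    have h2 : ∀ z : Fin k → Sph d, c r s z = ∑ i, (⟪y, (z r : Vec d)⟫ * ⟪e i, (z r : Vec d)⟫)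
        * (⟪y, (z s : Vec d)⟫ * ⟪e i, (z s : Vec d)⟫) := by
      intro z
      simp only [c]
      rw [← e.sum_inner_mul_inner (z r : Vec d) (z s : Vec d), Finset.mul_sum]
      refine Finset.sum_congr rfl fun i _ => ?_
      rw [real_inner_comm (e i) (z r : Vec d)]
      ring
    simp only [h2]
    rw [integral_finsetSum _ fun i _ => integrable_roundLaw_of_continuous (by fun_prop)]
    have h3 : ∀ i, ∫ z : Fin k → Sph d, (⟪y, (z r : Vec d)⟫ * ⟪e i, (z r : Vec d)⟫)
        * (⟪y, (z s : Vec d)⟫ * ⟪e i, (z s : Vec d)⟫) ∂(roundLaw d k)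
        = ⟪e i, y⟫ ^ 2 / d ^ 2 := by
      intro i
      rw [integral_roundLaw_mul hd hrs
        (g := fun z => ⟪y, (z : Vec d)⟫ * ⟪e i, (z : Vec d)⟫)
        (h := fun z => ⟪y, (z : Vec d)⟫ * ⟪e i, (z : Vec d)⟫) (by fun_prop) (by fun_prop),
        integral_inner_mul_inner_sphere hd, real_inner_comm]
      ring
    simp only [h3]
    rw [← Finset.sum_div, e.sum_sq_inner_right]
  have hrow : ∀ r, ∑ s, ∫ z, c r s z ∂(roundLaw d k)
      = ‖y‖ ^ 2 / d + (k - 1) * (‖y‖ ^ 2 / d ^ 2) := by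
    intro r
    rw [← Finset.add_sum_erase _ _ (Finset.mem_univ r), hdiag,
      Finset.sum_congr rfl fun s hs => hoff r s (Finset.ne_of_mem_erase hs).symm,
      Finset.sum_const, Finset.card_erase_of_mem (Finset.mem_univ r), Finset.card_univ,
      Fintype.card_fin, nsmul_eq_mul, Nat.cast_pred hk]
  simp only [h1]
  rw [integral_const_mul, integral_finsetSum _ fun r _ => integrable_finsetSum _ fun s _ =>
    hcint r s]
  rw [Finset.sum_congr rfl fun r _ => integral_finsetSum _ fun s _ => hcint r s]
  simp only [hrow]
  rw [Finset.sum_const, Finset.card_univ, Fintype.card_fin, nsmul_eq_mul]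
  field_simp
  ring

end Moments

lemma integral_le_of_integral_sq_le {Ω : Type*} [MeasurableSpace Ω] {Q : Measure Ω}
    [IsProbabilityMeasure Q] {g : Ω → ℝ} (hg : Integrable g Q)
    (hg2 : Integrable (fun x => g x ^ 2) Q) {c : ℝ} (hc : 0 ≤ c) (h : ∫ x, g x ^ 2 ∂Q ≤ c ^ 2) :
    ∫ x, g x ∂Q ≤ c := by
  set a := ∫ x, g x ∂Q with ha
  have h1 : 0 ≤ ∫ x, (g x - a) ^ 2 ∂Q := integral_nonneg fun x => sq_nonneg _
  have h2 : ∀ x, (g x - a) ^ 2 = g x ^ 2 - (2 * a * g x - a ^ 2) := fun x => by ring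
  simp only [h2] at h1
  have h3 : Integrable (fun x => 2 * a * g x) Q := hg.const_mul _
  have h4 : Integrable (fun x => 2 * a * g x - a ^ 2) Q := h3.sub (integrable_const _)
  rw [integral_sub hg2 h4, integral_sub h3 (integrable_const _), integral_const_mul, ← ha] at h1
  simp only [integral_const, probReal_univ, smul_eq_mul, one_mul] at h1
  exact le_of_sq_le_sq (by nlinarith) hc

lemma integral_norm_sketch_le {d k : ℕ} (hd : 0 < d) (hk : 0 < k) (y : Vec d) :
    ∫ z : Fin k → Sph d, ‖sketch z y‖ ∂(roundLaw d k)
      ≤ √(((d : ℝ) + k - 1) / k) * ‖y‖ := by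
  have := isProbabilityMeasure_sphereUniform hd
  have hcont := continuous_sketch_left (k := k) y
  have hd1 : (1 : ℝ) ≤ d := by exact_mod_cast hd
  refine integral_le_of_integral_sq_le (integrable_roundLaw_of_continuous hcont.norm)
    (integrable_roundLaw_of_continuous (hcont.norm.pow 2)) (by positivity) ?_
  rw [integral_norm_sketch_sq hd hk, mul_pow, Real.sq_sqrt]
  exact div_nonneg (by linarith [(Nat.cast_nonneg k : (0 : ℝ) ≤ k)]) (Nat.cast_nonneg k)

lemma two_mul_le_tau {d k : ℕ} (hd : 0 < d) (hk : 0 < k) :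
    2 * (((d : ℝ) + k - 1) / k) ≤ tau d k := by
  have hk1 : (1 : ℝ) ≤ k := by exact_mod_cast hk
  have hd1 : (1 : ℝ) ≤ √(d : ℝ) := Real.one_le_sqrt.2 (by exact_mod_cast hd)
  rw [tau, ← mul_div_assoc]
  gcongr
  nlinarith

lemma two_le_tau {d k : ℕ} (hd : 0 < d) (hk : 0 < k) : 2 ≤ tau d k := by
  refine le_trans ?_ (two_mul_le_tau hd hk)
  have hk1 : (1 : ℝ) ≤ k := by exact_mod_cast hk
  have hd1 : (1 : ℝ) ≤ d := by exact_mod_cast hd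
  have : 1 ≤ ((d : ℝ) + k - 1) / k := by
    rw [le_div_iff₀ (by linarith)]
    linarith
  linarith

/-! ### One round of the algorithm -/

/-- A gradient step along the sketch contracts distances in mean. The vectors `x` and `y` stand for
a difference of two points and the difference of the gradients there, which satisfy the
cocoercivity inequality `hxy`. -/
lemma integral_norm_sub_smul_sketch_le {d k : ℕ} (hd : 0 < d) (hk : 0 < k) {L lam : ℝ}
    (hlam : 0 < lam) (hle : lam ≤ L) {x y : Vec d}
    (hxy : ‖y‖ ^ 2 + lam * L * ‖x‖ ^ 2 ≤ (L + lam) * ⟪x, y⟫) :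
    ∫ z : Fin k → Sph d, ‖x - (1 / (2 * tau d k * L)) • sketch z y‖ ∂(roundLaw d k)
      ≤ (1 - lam / (2 * tau d k * (L + lam))) * ‖x‖ := by
  have := isProbabilityMeasure_sphereUniform hd
  have hτ := two_le_tau hd hk
  have hL : 0 < L := by linarith
  have hρ := two_mul_le_tau hd hk
  set ρ := ((d : ℝ) + k - 1) / k with hρdef
  set τ := tau d k with hτdef
  set η := 1 / (2 * τ * L) with hη
  set t := lam / (2 * τ * (L + lam)) with ht
  have hη0 : 0 < η := by positivity
  have ht1 : t ≤ 1 := by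
    rw [ht, div_le_one (by positivity)]
    nlinarith
  have hcont := continuous_sketch_left (k := k) y
  have hcont' : Continuous fun z : Fin k → Sph d => ‖x - η • sketch z y‖ := by fun_prop
  refine integral_le_of_integral_sq_le (integrable_roundLaw_of_continuous hcont')
    (integrable_roundLaw_of_continuous (hcont'.pow 2))
    (mul_nonneg (by linarith) (norm_nonneg _)) ?_
  have h1 : ∀ z : Fin k → Sph d, ‖x - η • sketch z y‖ ^ 2
      = ‖x‖ ^ 2 - (2 * η * ⟪x, sketch z y⟫ - η ^ 2 * ‖sketch z y‖ ^ 2) := by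
    intro z
    rw [norm_sub_sq_real, real_inner_smul_right, norm_smul, mul_pow, Real.norm_eq_abs, sq_abs]
    ring
  have hi1 : Integrable (fun z : Fin k → Sph d => 2 * η * ⟪x, sketch z y⟫) (roundLaw d k) :=
    integrable_roundLaw_of_continuous (by fun_prop)
  have hi2 : Integrable (fun z : Fin k → Sph d => η ^ 2 * ‖sketch z y‖ ^ 2) (roundLaw d k) :=
    integrable_roundLaw_of_continuous (by fun_prop)
  have hi3 : Integrable (fun z : Fin k → Sph d =>
      2 * η * ⟪x, sketch z y⟫ - η ^ 2 * ‖sketch z y‖ ^ 2) (roundLaw d k) := hi1.sub hi2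
  simp only [h1]
  rw [integral_sub (integrable_const _) hi3, integral_sub hi1 hi2, integral_const_mul,
    integral_const_mul, integral_inner_sketch hd hk, integral_norm_sketch_sq hd hk, ← hρdef]
  simp only [integral_const, probReal_univ, smul_eq_mul, one_mul]
  -- the step size is small enough for the variance term to be absorbed by cocoercivity
  have h2 : η ^ 2 * (ρ * ‖y‖ ^ 2) ≤ 2 * η / (L + lam) * ‖y‖ ^ 2 := by
    rw [← mul_assoc]
    gcongr
    have h3 : η * ρ ≤ 2 / (L + lam) := by
      calc η * ρ ≤ η * (τ / 2) := by gcongr; linarith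
        _ = 1 / (4 * L) := by rw [hη]; field_simp; norm_num
        _ ≤ 2 / (L + lam) := by
          rw [div_le_div_iff₀ (by positivity) (by positivity)]
          linarith
    calc η ^ 2 * ρ = η * (η * ρ) := by ring
      _ ≤ η * (2 / (L + lam)) := by gcongr
      _ = 2 * η / (L + lam) := by ring
  have h3 : 2 * η / (L + lam) * (‖y‖ ^ 2 + lam * L * ‖x‖ ^ 2) ≤ 2 * η * ⟪x, y⟫ := by
    calc 2 * η / (L + lam) * (‖y‖ ^ 2 + lam * L * ‖x‖ ^ 2)
        ≤ 2 * η / (L + lam) * ((L + lam) * ⟪x, y⟫) := by gcongr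
      _ = 2 * η * ⟪x, y⟫ := by field_simp
  have h4 : 2 * η / (L + lam) * (lam * L * ‖x‖ ^ 2) = 2 * t * ‖x‖ ^ 2 := by
    rw [hη, ht]
    field_simp
  have h5 : ((1 - t) * ‖x‖) ^ 2 = ‖x‖ ^ 2 - 2 * t * ‖x‖ ^ 2 + (t * ‖x‖) ^ 2 := by ring
  nlinarith [sq_nonneg (t * ‖x‖)]

/-- Finite differences approximate directional derivatives up to the smoothing radius. -/
lemma abs_meanCoeff_sub_le {d : ℕ} {F : Vec d → ℝ} {L : ℝ≥0} (hF : IsSmooth L F) {μ : ℝ}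
    (hμ : 0 < μ) (w : Vec d) (z : Sph d) :
    |meanCoeff F μ w z - d * ⟪gradient F w, (z : Vec d)⟫| ≤ d * L * μ / 2 := by
  have h1 := abs_le.1 (abs_sub_sub_inner_gradient_le hF.1 hF.2 w (μ • (z : Vec d)))
  have h2 := abs_le.1 (abs_sub_sub_inner_gradient_le hF.1 hF.2 w (-(μ • (z : Vec d))))
  have hz : ‖(z : Vec d)‖ = 1 := norm_eq_of_mem_sphere z
  simp only [inner_neg_right, real_inner_smul_right, norm_neg, norm_smul, hz, mul_one,
    Real.norm_eq_abs, sq_abs, ← sub_eq_add_neg] at h1 h2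
  have e : meanCoeff F μ w z - d * ⟪gradient F w, (z : Vec d)⟫
      = d * ((F (w + μ • (z : Vec d)) - F (w - μ • (z : Vec d))
        - 2 * μ * ⟪gradient F w, (z : Vec d)⟫) / (2 * μ)) := by
    rw [meanCoeff]
    field_simp
  rw [e, abs_mul, Nat.abs_cast, abs_div, abs_of_pos (show 0 < 2 * μ by positivity),
    show (d : ℝ) * L * μ / 2 = d * (L * μ / 2) by ring]
  refine mul_le_mul_of_nonneg_left ?_ (Nat.cast_nonneg d)
  rw [div_le_iff₀ (by positivity), abs_le]
  constructor <;> nlinarith [h1.1, h1.2, h2.1, h2.2]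

/-- At a local minimum of the smoothed loss the gradient of the loss itself is of the order of the
smoothing radius. The quadratic upper bound, averaged over the sphere, takes the place of
differentiation under the integral sign. -/
lemma norm_gradient_le_of_isLocalMin_smoothedLoss {d : ℕ} (hd : 0 < d) {F : Vec d → ℝ} {L : ℝ≥0}
    (hF : IsSmooth L F) {μ : ℝ} (hμ : 0 < μ) {w : Vec d} (hw : IsLocalMin (smoothedLoss F μ) w) :
    ‖gradient F w‖ ≤ L * μ := by
  have := isProbabilityMeasure_sphereUniform hd
  have hFc : Continuous F := hF.1.continuous
  have hup : ∀ h : Vec d, smoothedLoss F μ (w + h)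
      ≤ smoothedLoss F μ w + (⟪gradient F w, h⟫ + L * μ * ‖h‖ + L / 2 * ‖h‖ ^ 2) := by
    intro h
    have hpt : ∀ z : Sph d, F (w + h + μ • (z : Vec d)) ≤ F (w + μ • (z : Vec d))
        + (⟪gradient F w, h⟫ + L * μ * ‖h‖ + L / 2 * ‖h‖ ^ 2) := by
      intro z
      have h1 := (abs_le.1 (abs_sub_sub_inner_gradient_le hF.1 hF.2 (w + μ • (z : Vec d)) h)).2
      have h2 : ⟪gradient F (w + μ • (z : Vec d)) - gradient F w, h⟫ ≤ L * μ * ‖h‖ := by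
        refine (real_inner_le_norm _ _).trans ?_
        have h3 := hF.2.dist_le_mul (w + μ • (z : Vec d)) w
        rw [dist_eq_norm, dist_eq_norm, add_sub_cancel_left, norm_smul, norm_eq_of_mem_sphere,
          mul_one, Real.norm_of_nonneg hμ.le] at h3
        gcongr
      rw [inner_sub_left] at h2
      rw [show w + h + μ • (z : Vec d) = w + μ • (z : Vec d) + h by abel]
      linarith
    have hi1 : Integrable (fun z : Sph d => F (w + h + μ • (z : Vec d))) (sphereUniform d) :=
      integrable_sphere_of_continuous (by fun_prop)
    have hi2 : Integrable (fun z : Sph d => F (w + μ • (z : Vec d))) (sphereUniform d) :=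
      integrable_sphere_of_continuous (by fun_prop)
    have := integral_mono hi1 (hi2.add (integrable_const _)) hpt
    simp only [Pi.add_apply] at this
    rw [integral_add hi2 (integrable_const _)] at this
    simpa [smoothedLoss] using this
  set g := gradient F w with hg
  have hev : ∀ᶠ s : ℝ in nhdsWithin 0 (Ioi 0), ‖g‖ ^ 2 - L / 2 * ‖g‖ ^ 2 * s ≤ L * μ * ‖g‖ := by
    have ht : Filter.Tendsto (fun s : ℝ => w + (-s) • g) (nhdsWithin 0 (Ioi 0)) (nhds w) := by
      have hc : Continuous fun s : ℝ => w + (-s) • g := by fun_prop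
      have := (hc.tendsto 0).mono_left (nhdsWithin_le_nhds (s := Ioi 0))
      simpa using this
    filter_upwards [ht.eventually hw, self_mem_nhdsWithin] with s hs hs0
    have hs0' : (0 : ℝ) < s := hs0
    have h1 := hs.trans (hup ((-s) • g))
    rw [real_inner_smul_right, real_inner_self_eq_norm_sq, norm_smul, norm_neg,
      Real.norm_of_nonneg hs0'.le] at h1
    refine le_of_mul_le_mul_left ?_ hs0'
    nlinarith
  have hlim : Filter.Tendsto (fun s : ℝ => ‖g‖ ^ 2 - L / 2 * ‖g‖ ^ 2 * s)
      (nhdsWithin 0 (Ioi 0)) (nhds (‖g‖ ^ 2 - L / 2 * ‖g‖ ^ 2 * 0)) :=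
    ((by fun_prop : Continuous fun s : ℝ => ‖g‖ ^ 2 - L / 2 * ‖g‖ ^ 2 * s).tendsto 0).mono_left
      nhdsWithin_le_nhds
  have h2 := le_of_tendsto hlim hev
  rcases (norm_nonneg g).eq_or_lt with h | h
  · rw [← h]
    positivity
  · refine le_of_mul_le_mul_right ?_ h
    nlinarith

section Iteration

variable {d k m n : ℕ} {Γ : Type*} {f : Vec d → Γ → ℝ} {W : Set (Vec d)} {μ β η : ℝ}
  {B : Finset (Fin m)} {samples : Fin m → Fin n → Γ} {adv : Strategy d k m} {w₀ : Vec d}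

lemma norm_robustGradient_sub_sketch_le (hk : 0 < k) {F : Vec d → ℝ} {L : ℝ≥0}
    (hF : IsSmooth L F) (hμ : 0 < μ) {Δ : ℝ} {w : Vec d}
    (hrob : ∀ z ∈ Metric.sphere (0 : Vec d) 1, ∀ a : Fin m → ℝ,
      |trimmedMean β (messages f μ B samples w z a) - meanCoeff F μ w z| ≤ Δ)
    (z : Fin k → Sph d) (a : Fin m → Fin k → ℝ) :
    ‖robustGradient f μ β B samples w z a - sketch z (gradient F w)‖ ≤ Δ + d * L * μ / 2 := by
  have e : robustGradient f μ β B samples w z a - sketch z (gradient F w)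
      = (1 / k : ℝ) • ∑ r, (trimmedMean β (messages f μ B samples w (z r) (fun i => a i r))
        - d * ⟪gradient F w, (z r : Vec d)⟫) • (z r : Vec d) := by
    simp only [robustGradient, sketch, sub_smul, Finset.sum_sub_distrib, smul_sub]
  rw [e]
  refine norm_average_smul_sphere_le hk z fun r => ?_
  have h1 := hrob (z r) (z r).2 fun i => a i r
  have h2 := abs_meanCoeff_sub_le hF hμ w (z r)
  calc _ = |(trimmedMean β (messages f μ B samples w (z r) (fun i => a i r))
        - meanCoeff F μ w (z r)) + (meanCoeff F μ w (z r)
        - d * ⟪gradient F w, (z r : Vec d)⟫)| := by congr 1; ring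
    _ ≤ _ := (abs_add_le _ _).trans (add_le_add h1 h2)

lemma iterate_mem (hW : IsCompact W) (hw₀ : w₀ ∈ W) :
    ∀ (t : ℕ) (Z : Fin t → Fin k → Sph d),
      iterate f W μ β η B samples adv w₀ t Z ∈ W
  | 0, _ => hw₀
  | _ + 1, _ => euclideanProj_mem ⟨w₀, hw₀⟩ hW _

lemma measurable_robustGradient (hf : ∀ γ, Continuous fun w => f w γ) :
    Measurable fun p : Vec d × (Fin k → Sph d) × (Fin m → Fin k → ℝ) =>
      robustGradient f μ β B samples p.1 p.2.1 p.2.2 := by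
  unfold robustGradient
  refine (Finset.measurable_sum _ fun r _ => ?_).const_smul (1 / k : ℝ)
  refine Measurable.smul ((measurable_trimmedMean β).comp (measurable_pi_lambda _ fun i => ?_)) ?_
  · unfold messages
    split_ifs
    · fun_prop
    · have hz : Continuous fun p : Vec d × (Fin k → Sph d) × (Fin m → Fin k → ℝ) =>
          clientCoeff f μ (samples i) p.1 (p.2.1 r) := by
        unfold clientCoeff zoCoeff
        refine continuous_const.mul (continuous_finsetSum _ fun j _ => continuous_const.mul
          (Continuous.div_const (Continuous.sub ?_ ?_) _))
        · exact (hf (samples i j)).comp (by fun_prop)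
        · exact (hf (samples i j)).comp (by fun_prop)
      exact hz.measurable
  · fun_prop

lemma measurable_iterate (hf : ∀ γ, Continuous fun w => f w γ) (hc : Convex ℝ W)
    (hW : IsCompact W) (hw₀ : w₀ ∈ W) (t : ℕ) :
    Measurable fun Z : Fin t → Fin k → Sph d => iterate f W μ β η B samples adv w₀ t Z := by
  induction t with
  | zero => exact measurable_const
  | succ t ih =>
    have hpast : Measurable fun Z : Fin (t + 1) → Fin k → Sph d =>
        iterate f W μ β η B samples adv w₀ t (fun s => Z s.castSucc) :=
      ih.comp (measurable_pi_lambda _ fun s => measurable_pi_apply _)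
    have hproj := (lipschitzWith_euclideanProj ⟨w₀, hw₀⟩ hc hW).continuous.measurable
    exact hproj.comp (hpast.sub (((measurable_robustGradient hf).comp
      (hpast.prodMk ((measurable_pi_apply (Fin.last t)).prodMk
        (adv.measurable_send t)))).const_smul η))

/-- The deterministic estimate for one round: the distance to `wstar ∈ W` after the round is
controlled by a gradient step for the loss and three error terms. -/
lemma norm_iterate_succ_sub_le (hk : 0 < k) (hc : Convex ℝ W) (hW : IsCompact W) (hw₀ : w₀ ∈ W)
    {F : Vec d → ℝ} {L : ℝ≥0} (hF : IsSmooth L F) (hμ : 0 < μ) (hη : 0 ≤ η) {Δ : ℝ}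
    (hrob : ∀ w ∈ W, ∀ z ∈ Metric.sphere (0 : Vec d) 1, ∀ a : Fin m → ℝ,
      |trimmedMean β (messages f μ B samples w z a) - meanCoeff F μ w z| ≤ Δ)
    {wstar : Vec d} (hstar : wstar ∈ W) {t : ℕ} (Z : Fin (t + 1) → Fin k → Sph d) {w : Vec d}
    (hw : w = iterate f W μ β η B samples adv w₀ t (fun s => Z s.castSucc)) :
    ‖iterate f W μ β η B samples adv w₀ (t + 1) Z - wstar‖
      ≤ ‖(w - wstar) - η • sketch (Z (Fin.last t)) (gradient F w - gradient F wstar)‖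
        + η * ‖sketch (Z (Fin.last t)) (gradient F wstar)‖ + η * (Δ + d * L * μ / 2) := by
  have hwW : w ∈ W := hw ▸ iterate_mem hW hw₀ t _
  set g := robustGradient f μ β B samples w (Z (Fin.last t)) (adv.send t Z) with hg
  have e : iterate f W μ β η B samples adv w₀ (t + 1) Z = euclideanProj W (w - η • g) := by
    rw [hg, hw]
    rfl
  have h1 := (lipschitzWith_euclideanProj ⟨w₀, hw₀⟩ hc hW).dist_le_mul (w - η • g) wstar
  rw [euclideanProj_of_mem hW hstar, NNReal.coe_one, one_mul, dist_eq_norm, dist_eq_norm] at h1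
  rw [e]
  refine h1.trans ?_
  set z := Z (Fin.last t) with hz
  have h2 := norm_robustGradient_sub_sketch_le hk hF hμ (hrob w hwW) z (adv.send t Z)
  rw [← hg] at h2
  have e2 : w - η • g - wstar = ((w - wstar) - η • sketch z (gradient F w - gradient F wstar))
      - η • sketch z (gradient F wstar) - η • (g - sketch z (gradient F w)) := by
    rw [sketch_sub]
    module
  rw [e2]
  refine (norm_sub_le _ _).trans (add_le_add ((norm_sub_le _ _).trans ?_) ?_)
  · rw [norm_smul η, Real.norm_of_nonneg hη]
  · rw [norm_smul, Real.norm_of_nonneg hη]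
    gcongr

lemma integrable_norm_iterate_sub (hd : 0 < d) (hf : ∀ γ, Continuous fun w => f w γ)
    (hc : Convex ℝ W) (hW : IsCompact W) (hw₀ : w₀ ∈ W) {wstar : Vec d} (hstar : wstar ∈ W)
    (t : ℕ) :
    Integrable (fun Z : Fin t → Fin k → Sph d =>
      ‖iterate f W μ β η B samples adv w₀ t Z - wstar‖) (directionsLaw d k t) := by
  have := isProbabilityMeasure_sphereUniform hd
  unfold directionsLaw
  refine Integrable.of_bound
    ((measurable_iterate hf hc hW hw₀ t).sub_const wstar).norm.aestronglyMeasurable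
    (Metric.diam W) (Filter.Eventually.of_forall fun Z => ?_)
  rw [norm_norm, ← dist_eq_norm]
  exact Metric.dist_le_diam_of_mem hW.isBounded (iterate_mem hW hw₀ t Z) hstar

/-- The recursion for the expected distance: conditionally on the past rounds, the bound of
`norm_iterate_succ_sub_le` depends on the directions of the last round only, whatever the
Byzantine clients send. -/
lemma integral_norm_iterate_succ_le (hd : 0 < d) (hk : 0 < k)
    (hf : ∀ γ, Continuous fun w => f w γ) (hc : Convex ℝ W) (hW : IsCompact W) (hw₀ : w₀ ∈ W)
    {F : Vec d → ℝ} {L : ℝ≥0} (hF : IsSmooth L F) {lam : ℝ} (hlam : 0 < lam)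
    (hsc : StrongConvexOn univ lam F) (hle : lam ≤ L) (hμ : 0 < μ) {Δ : ℝ}
    (hrob : ∀ w ∈ W, ∀ z ∈ Metric.sphere (0 : Vec d) 1, ∀ a : Fin m → ℝ,
      |trimmedMean β (messages f μ B samples w z a) - meanCoeff F μ w z| ≤ Δ)
    {wstar : Vec d} (hstar : wstar ∈ W) (hη : η = 1 / (2 * tau d k * L)) (t : ℕ) :
    ∫ Z, ‖iterate f W μ β η B samples adv w₀ (t + 1) Z - wstar‖ ∂(directionsLaw d k (t + 1))
      ≤ (1 - lam / (2 * tau d k * (L + lam)))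
          * ∫ Z, ‖iterate f W μ β η B samples adv w₀ t Z - wstar‖ ∂(directionsLaw d k t)
        + η * (√(((d : ℝ) + k - 1) / k) * ‖gradient F wstar‖ + (Δ + d * L * μ / 2)) := by
  have := isProbabilityMeasure_sphereUniform hd
  have hτ := two_le_tau hd hk
  have hη0 : 0 ≤ η := by
    rw [hη]
    positivity
  have hprob : IsProbabilityMeasure (directionsLaw d k t) := by
    unfold directionsLaw
    infer_instance
  have hgc : Continuous (gradient F) := hF.2.continuous
  set κ := η * (Δ + d * L * μ / 2) with hκ
  let wt : (Fin t → Fin k → Sph d) → Vec d := fun Z => iterate f W μ β η B samples adv w₀ t Z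
  have hwt : Measurable wt := measurable_iterate hf hc hW hw₀ t
  have hwtW : ∀ Z, wt Z ∈ W := fun Z => iterate_mem hW hw₀ t Z
  let Φ : (Fin k → Sph d) × (Fin t → Fin k → Sph d) → ℝ := fun p =>
    ‖(wt p.2 - wstar) - η • sketch p.1 (gradient F (wt p.2) - gradient F wstar)‖
      + η * ‖sketch p.1 (gradient F wstar)‖ + κ
  have hΦm : Measurable Φ := by
    have hs : Measurable fun p : (Fin k → Sph d) × Vec d => sketch p.1 p.2 :=
      continuous_sketch.measurable
    have hg : Measurable fun p : (Fin k → Sph d) × (Fin t → Fin k → Sph d) =>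
        (p.1, gradient F (wt p.2) - gradient F wstar) :=
      measurable_fst.prodMk ((hgc.measurable.comp (hwt.comp measurable_snd)).sub_const _)
    have h1 := hs.comp hg
    have h2 : Measurable fun p : (Fin k → Sph d) × (Fin t → Fin k → Sph d) =>
        sketch p.1 (gradient F wstar) :=
      (continuous_sketch_left _).measurable.comp measurable_fst
    exact (((((hwt.comp measurable_snd).sub_const _).sub (h1.const_smul η)).norm).add
      (h2.norm.const_mul η)).add_const κ
  have hx : ∀ Z, ‖wt Z - wstar‖ ≤ Metric.diam W := fun Z => by
    rw [← dist_eq_norm]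
    exact Metric.dist_le_diam_of_mem hW.isBounded (hwtW Z) hstar
  have hΦint : Integrable Φ ((roundLaw d k).prod (directionsLaw d k t)) := by
    refine Integrable.of_bound hΦm.aestronglyMeasurable
      ((Metric.diam W + η * (d * (L * Metric.diam W))) + η * (d * ‖gradient F wstar‖) + |κ|)
      (Filter.Eventually.of_forall fun p => ?_)
    refine (norm_add_le _ _).trans (add_le_add ((norm_add_le _ _).trans (add_le_add ?_ ?_)) le_rfl)
    · rw [norm_norm]
      refine (norm_sub_le _ _).trans (add_le_add (hx p.2) ?_)
      rw [norm_smul, Real.norm_of_nonneg hη0]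
      gcongr
      refine (norm_sketch_le hk _ _).trans ?_
      gcongr
      have h1 := hF.2.dist_le_mul (wt p.2) wstar
      rw [dist_eq_norm, dist_eq_norm] at h1
      exact h1.trans (by gcongr; exact hx p.2)
    · rw [norm_mul, norm_norm, Real.norm_of_nonneg hη0]
      gcongr
      exact norm_sketch_le hk _ _
  have hmp := measurePreserving_piFinSuccAbove (fun _ : Fin (t + 1) => roundLaw d k) (Fin.last t)
  have hle1 : ∫ Z, ‖iterate f W μ β η B samples adv w₀ (t + 1) Z - wstar‖
        ∂(directionsLaw d k (t + 1))
      ≤ ∫ p, Φ p ∂((roundLaw d k).prod (directionsLaw d k t)) := by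
    have h1 : ∫ p, Φ p ∂((roundLaw d k).prod (directionsLaw d k t))
        = ∫ Z, Φ (MeasurableEquiv.piFinSuccAbove (fun _ : Fin (t + 1) => Fin k → Sph d)
          (Fin.last t) Z) ∂(directionsLaw d k (t + 1)) := (hmp.integral_comp' Φ).symm
    rw [h1]
    refine integral_mono (integrable_norm_iterate_sub hd hf hc hW hw₀ hstar (t + 1))
      (hmp.integrable_comp_of_integrable hΦint) fun Z => ?_
    have h2 := norm_iterate_succ_sub_le (adv := adv) hk hc hW hw₀ hF hμ hη0 hrob hstar Z rfl
    refine h2.trans_eq ?_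
    have h3 : MeasurableEquiv.piFinSuccAbove (fun _ : Fin (t + 1) => Fin k → Sph d)
        (Fin.last t) Z = (Z (Fin.last t), fun s => Z s.castSucc) := by
      refine Prod.ext rfl (funext fun s => ?_)
      change Z ((Fin.last t).succAbove s) = _
      rw [Fin.succAbove_last]
    rw [h3]
  refine hle1.trans ?_
  rw [integral_prod_symm _ hΦint]
  have hint := integrable_norm_iterate_sub (k := k) (μ := μ) (β := β) (η := η) (B := B)
    (samples := samples) (adv := adv) hd hf hc hW hw₀ hstar t
  have hinner : ∀ Z, ∫ z, Φ (z, Z) ∂(roundLaw d k)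
      ≤ (1 - lam / (2 * tau d k * (L + lam))) * ‖wt Z - wstar‖
        + η * (√(((d : ℝ) + k - 1) / k) * ‖gradient F wstar‖ + (Δ + d * L * μ / 2)) := by
    intro Z
    have hi1 : Integrable (fun z : Fin k → Sph d => ‖(wt Z - wstar)
        - η • sketch z (gradient F (wt Z) - gradient F wstar)‖) (roundLaw d k) :=
      integrable_roundLaw_of_continuous
        (continuous_const.sub ((continuous_sketch_left _).const_smul η)).norm
    have hi2 : Integrable (fun z : Fin k → Sph d => η * ‖sketch z (gradient F wstar)‖)
        (roundLaw d k) :=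
      integrable_roundLaw_of_continuous (continuous_const.mul (continuous_sketch_left _).norm)
    have h1 := integral_norm_sub_smul_sketch_le (k := k) hd hk hlam hle
      (StrongConvexOn.inner_gradient_sub_ge hF.1 hF.2 hsc hle (wt Z) wstar)
    have h2 := mul_le_mul_of_nonneg_left (integral_norm_sketch_le hd hk (gradient F wstar)) hη0
    rw [← hη] at h1
    simp only [Φ]
    have hi3 : Integrable (fun z : Fin k → Sph d => ‖(wt Z - wstar)
        - η • sketch z (gradient F (wt Z) - gradient F wstar)‖
        + η * ‖sketch z (gradient F wstar)‖) (roundLaw d k) := hi1.add hi2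
    rw [integral_add hi3 (integrable_const _), integral_add hi1 hi2, integral_const_mul]
    simp only [integral_const, probReal_univ, smul_eq_mul, one_mul]
    linarith
  refine (integral_mono hΦint.integral_prod_right
    ((hint.const_mul _).add (integrable_const _)) hinner).trans_eq ?_
  simp only [Pi.add_apply]
  rw [integral_add (hint.const_mul _) (integrable_const _), integral_const_mul]
  simp

end Iteration

/-- The per-round error is at most the fraction of the final error which the contraction
removes per round. -/
lemma round_error_le {d k : ℕ} (hd : 0 < d) (hk : 0 < k) {L lam μ Δ g : ℝ} (hlam : 0 < lam)
    (hle : lam ≤ L) (hμ : 0 < μ) (hΔ : 0 ≤ Δ) (hg : g ≤ L * μ) :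
    1 / (2 * tau d k * L) * (√(((d : ℝ) + k - 1) / k) * g + (Δ + d * L * μ / 2))
      ≤ lam / (2 * tau d k * (L + lam))
        * (2 / lam * Δ + 8 * √2 * μ * d * L / lam * √(1 + tau d k / 4)) := by
  have hτ := two_le_tau hd hk
  have hρ := two_mul_le_tau hd hk
  set ρ := ((d : ℝ) + k - 1) / k with hρdef
  set τ := tau d k with hτdef
  have hL : 0 < L := by linarith
  have hd1 : (1 : ℝ) ≤ d := by exact_mod_cast hd
  set R := √(1 + τ / 4) with hR
  have hR1 : 1 ≤ R := Real.one_le_sqrt.2 (by linarith)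
  have h2 : (1 : ℝ) ≤ √2 := Real.one_le_sqrt.2 (by norm_num)
  have hρR : √ρ ≤ √2 * R := by
    rw [hR, ← Real.sqrt_mul (by norm_num)]
    exact Real.sqrt_le_sqrt (by linarith)
  have hdR : (d : ℝ) ≤ √2 * d * R := by
    calc (d : ℝ) = 1 * d * 1 := by ring
      _ ≤ √2 * d * R := by gcongr
  have hdR2 : √2 * R ≤ √2 * d * R := by
    calc √2 * R = √2 * 1 * R := by ring
      _ ≤ √2 * d * R := by gcongr
  have h0 : 0 ≤ √2 * d * R := by positivity
  have h3 : √ρ * g + (Δ + d * L * μ / 2) ≤ Δ + 4 * (√2 * d * R) * (L * μ) := by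
    have h4 : √ρ * g ≤ (√2 * d * R) * (L * μ) := by
      calc √ρ * g ≤ √ρ * (L * μ) := by gcongr
        _ ≤ (√2 * d * R) * (L * μ) := by gcongr; linarith
    have h5 : d * L * μ / 2 ≤ (√2 * d * R) * (L * μ) := by
      have : (d : ℝ) * (L * μ) ≤ (√2 * d * R) * (L * μ) := by gcongr
      have : 0 ≤ (d : ℝ) * (L * μ) := by positivity
      linarith
    have : 0 ≤ (√2 * d * R) * (L * μ) := by positivity
    linarith
  have e : lam / (2 * τ * (L + lam)) * (2 / lam * Δ + 8 * √2 * μ * d * L / lam * R)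
      = 2 / (2 * τ * (L + lam)) * (Δ + 4 * (√2 * d * R) * (L * μ)) := by
    field_simp
    ring
  rw [e]
  have h6 : 1 / (2 * τ * L) ≤ 2 / (2 * τ * (L + lam)) := by
    rw [div_le_div_iff₀ (by positivity) (by positivity)]
    nlinarith
  calc 1 / (2 * τ * L) * (√ρ * g + (Δ + d * L * μ / 2))
      ≤ 1 / (2 * τ * L) * (Δ + 4 * (√2 * d * R) * (L * μ)) := by gcongr
    _ ≤ _ := by
      refine mul_le_mul_of_nonneg_right h6 ?_
      positivity

end CyberZero

/-! ### Convergence -/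

theorem mainTheorem3 :
    -- the absolute constant implied in the `Õ`-term of `Δ`
    ∃ C : ℝ, 0 < C ∧
    ∀ {Γ : Type*} [MeasurableSpace Γ] (P : Measure Γ) [IsProbabilityMeasure P]
      (d k m n : ℕ) (_ : 0 < d) (_ : 0 < k) (_ : 0 < m) (_ : 0 < n)
      -- the loss, whose population version is well defined
      (f : CyberZero.Vec d → Γ → ℝ) (_ : ∀ w, Integrable (f w) P)
      -- the constraint set
      (W : Set (CyberZero.Vec d)) (_ : Convex ℝ W) (_ : IsCompact W)
      (D : ℝ) (_ : D = Metric.diam W)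
      (μ : ℝ) (_ : 0 < μ)
      -- smoothness
      (L Lw Lz LF : ℝ≥0)
      (_ : ∀ γ, ∀ z ∈ Metric.sphere (0 : CyberZero.Vec d) 1,
        LipschitzOnWith Lw (fun w => CyberZero.zoCoeff f μ w z γ) W)
      (_ : ∀ γ, ∀ w ∈ W,
        LipschitzOnWith Lz (fun z => CyberZero.zoCoeff f μ w z γ) (Metric.sphere 0 1))
      (_ : ∀ γ, CyberZero.IsSmooth L (fun w => f w γ))
      (_ : CyberZero.IsSmooth LF (CyberZero.populationLoss P f))
      -- sub-exponentiality
      (v : ℝ) (_ : 0 < v)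
      (_ : ∀ w ∈ W, ∀ z ∈ Metric.sphere (0 : CyberZero.Vec d) 1,
        CyberZero.IsSubExponential P v (CyberZero.zoCoeff f μ w z))
      -- strong convexity
      (lam : ℝ) (_ : 0 < lam)
      (_ : StrongConvexOn univ lam (CyberZero.populationLoss P f))
      -- the minimiser over `W` of the smoothed loss, a local minimum of the smoothed loss
      (wstar : CyberZero.Vec d) (_ : wstar ∈ W)
      (_ : IsMinOn (CyberZero.smoothedLoss (CyberZero.populationLoss P f) μ) W wstar)
      (_ : IsLocalMin (CyberZero.smoothedLoss (CyberZero.populationLoss P f) μ) wstar)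
      -- the Byzantine clients, a fraction `α` of all clients, and the trimming factor
      (B : Finset (Fin m)) (α β ε : ℝ) (_ : (B.card : ℝ) = α * m)
      (_ : 0 < ε) (_ : α ≤ β) (_ : β < 1 / 2 - ε),
    -- an event in the space of samples
    ∃ G : Set (Fin m → Fin n → Γ), MeasurableSet G ∧
      1 - CyberZero.failureProb d n m (Lw + Lz) D ≤ (CyberZero.samplesLaw P m n).real G ∧
      ∀ samples ∈ G, ∀ (adv : CyberZero.Strategy d k m), ∀ w₀ ∈ W, ∀ T : ℕ,
        Integrable (fun Z : Fin T → Fin k → CyberZero.Sph d =>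
          ‖CyberZero.iterate f W μ β (1 / (2 * CyberZero.tau d k * LF)) B samples adv w₀ T Z
            - wstar‖) (CyberZero.directionsLaw d k T) ∧
        ∫ Z, ‖CyberZero.iterate f W μ β (1 / (2 * CyberZero.tau d k * LF)) B samples adv w₀ T Z
            - wstar‖ ∂(CyberZero.directionsLaw d k T)
          ≤ (1 - lam / (2 * CyberZero.tau d k * (LF + lam))) ^ T * ‖w₀ - wstar‖
            + 2 / lam * CyberZero.robustnessError C d n m v ε β (Lw + Lz) D
            + 8 * √2 * μ * d * LF / lam * √(1 + CyberZero.tau d k / 4) := by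
  refine ⟨8, by norm_num, ?_⟩
  intro Γ _ P _ d k m n hd hk hm hn f hf W hWc hW D hD μ hμ L Lw Lz LF hLw hLz hfs hF v hv hX
    lam hlam hsc wstar hstar _ hloc B α β ε hα hε hαβ hβ
  subst hD
  obtain ⟨G, hG, hGP, hrob⟩ := CyberZero.exists_event_robust hd hm hn hf ⟨wstar, hstar⟩
    hW.isBounded hLw hLz hv hX hα hε hαβ hβ
  refine ⟨G, hG, hGP, fun samples hs adv w₀ hw₀ => ?_⟩
  have hfc : ∀ γ, Continuous fun w => f w γ := fun γ => (hfs γ).1.continuous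
  have : Nonempty (Fin d) := ⟨⟨0, hd⟩⟩
  have hle : lam ≤ LF := CyberZero.StrongConvexOn.le_lipschitz hF.1 hF.2 hsc
  have hτ := CyberZero.two_le_tau hd hk
  have hΔ : 0 ≤ CyberZero.robustnessError 8 d n m v ε β (Lw + Lz) (Metric.diam W) := by
    obtain ⟨z, hz⟩ := (NormedSpace.sphere_nonempty (x := (0 : CyberZero.Vec d))).2 zero_le_one
    exact (abs_nonneg _).trans (hrob samples hs wstar hstar z hz 0)
  have hg := CyberZero.norm_gradient_le_of_isLocalMin_smoothedLoss hd hF hμ hloc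
  have hround := CyberZero.round_error_le hd hk hlam hle hμ hΔ hg
  set K := 2 / lam * CyberZero.robustnessError 8 d n m v ε β (Lw + Lz) (Metric.diam W)
    + 8 * √2 * μ * d * LF / lam * √(1 + CyberZero.tau d k / 4) with hK
  set t := lam / (2 * CyberZero.tau d k * (LF + lam)) with ht
  have hK0 : 0 ≤ K := by positivity
  have ht1 : t ≤ 1 := by
    have hLF : (0 : ℝ) ≤ LF := LF.coe_nonneg
    rw [ht, div_le_one (by positivity)]
    nlinarith
  intro T
  refine ⟨CyberZero.integrable_norm_iterate_sub hd hfc hWc hW hw₀ hstar T, ?_⟩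
  rw [add_assoc, ← hK]
  induction T with
  | zero =>
    have hp : IsProbabilityMeasure (CyberZero.directionsLaw d k 0) := by
      have := CyberZero.isProbabilityMeasure_sphereUniform hd
      unfold CyberZero.directionsLaw
      infer_instance
    simpa [CyberZero.iterate] using hK0
  | succ T ih =>
    have hstep := CyberZero.integral_norm_iterate_succ_le (adv := adv) hd hk hfc hWc hW hw₀ hF hlam
      hsc hle hμ (hrob samples hs) hstar rfl T
    have h1 := mul_le_mul_of_nonneg_left ih (sub_nonneg.2 ht1)
    rw [← ht] at hstep
    calc _ ≤ _ := hstep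
      _ ≤ (1 - t) * ((1 - t) ^ T * ‖w₀ - wstar‖ + K) + t * K := add_le_add h1 hround
      _ = (1 - t) ^ (T + 1) * ‖w₀ - wstar‖ + K := by ring
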